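/- Conventions. A lattice polytope in $\mathbb{R}^n$ is the convex hull of finitely many points of $\mathbb{Z}^n$; a (lattice) $d$-polytope is one whose affine span has dimension $d$. Two lattice polytopes $P\subset\mathbb{R}^n$ and $P'\subset\mathbb{R}^{n'}$ are integrally equivalent if some affine map $\operatorname{aff}P\to\operatorname{aff}P'$ maps $\mathbb{Z}^n\cap\operatorname{aff}P$ bijectively onto $\mathbb{Z}^{n'}\cap\operatorname{aff}P'$ and $P$ onto $P'$. For a vertex $u$ of $P$, let $T_uP=\operatorname{cone}(u'-u\mid u'\in P)$ be the tangent cone, inside the linear space $V$ parallel to $\operatorname{aff}P$; the normal cone of $P$ at $u$ is its dual $\{\varphi\in V^*\mid \varphi\ge 0\text{ on }T_uP\}$, and $V^*$ carries the lattice of all $\varphi$ taking integer values on $V\cap\mathbb{Z}^n$. A rational cone in $\mathbb{R}^m$ is a cone generated by finitely many vectors of $\mathbb{Z}^m$; it is a $d$-cone if its linear span has dimension $d$. Two cones $\sigma,\tau$ in real vector spaces with lattices are integrally equivalent if some linear isomorphism $\operatorname{span}\sigma\to\operatorname{span}\tau$ maps the lattice points of $\operatorname{span}\sigma$ onto those of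 $\operatorname{span}\tau$ and $\sigma$ onto $\tau$. Theorem. Let $N$ be a nonnegative integer. (1) Let $d$ be a nonnegative integer and let $\mathcal F$ be a finite family of rational $d$-cones. Then, up to integral equivalence, there are only finitely many lattice $d$-polytopes with exactly $N+1$ lattice points all of whose normal cones (at vertices) are integrally equivalent to cones in $\mathcal F$. (2) More generally, let $\mathcal F$ be a finite family of rational cones, of arbitrary dimensions. Then, up to integral equivalence, there are only finitely many lattice polytopes (of arbitrary dimension) with exactly $N+1$ lattice points all of whose normal cones are integrally equivalent to cones in $\mathcal F$. -/

import Mathlib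

namespace LatticePolytopes

/-- The lattice `ℤⁿ ⊂ ℝⁿ`. -/
def intLattice (n : ℕ) : Set (Fin n → ℝ) :=
  Set.range fun (z : Fin n → ℤ) (i : Fin n) => (z i : ℝ)

/-- A lattice polytope in `ℝⁿ`: the convex hull of finitely many points of `ℤⁿ`. -/
def IsLatticePolytope {n : ℕ} (P : Set (Fin n → ℝ)) : Prop :=
  ∃ S : Set (Fin n → ℝ), S.Finite ∧ S ⊆ intLattice n ∧ P = convexHull ℝ S

/-- The linear space parallel to the affine span of `P`. -/
abbrev dirSpace {n : ℕ} (P : Set (Fin n → ℝ)) : Submodule ℝ (Fin n → ℝ) :=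
  (affineSpan ℝ P).direction

/-- The dimension of a (nonempty) polytope, that is, of its affine span. -/
noncomputable def polytopeDim {n : ℕ} (P : Set (Fin n → ℝ)) : ℕ :=
  Module.finrank ℝ (dirSpace P)

/-- Integral equivalence of lattice polytopes `P ⊂ ℝⁿ` and `Q ⊂ ℝᵐ`: an affine map carries
`ℤⁿ ∩ aff P` bijectively onto `ℤᵐ ∩ aff Q`, and `P` onto `Q`. (An affine map defined on `aff P`
is the same as the restriction to `aff P` of an affine map defined on `ℝⁿ`.) -/
def IntegrallyEquivalent {n m : ℕ} (P : Set (Fin n → ℝ)) (Q : Set (Fin m → ℝ)) : Prop :=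
  ∃ f : (Fin n → ℝ) →ᵃ[ℝ] (Fin m → ℝ),
    Set.BijOn f (intLattice n ∩ affineSpan ℝ P) (intLattice m ∩ affineSpan ℝ Q) ∧ f '' P = Q

/-- A rational cone in `ℝᵐ`: generated by finitely many points of `ℤᵐ`. -/
def IsRationalCone {m : ℕ} (σ : PointedCone ℝ (Fin m → ℝ)) : Prop :=
  ∃ S : Set (Fin m → ℝ), S.Finite ∧ S ⊆ intLattice m ∧ σ = PointedCone.hull ℝ S

/-- The dimension of a cone, that is, of its linear span. -/
noncomputable def coneDim {V : Type*} [AddCommGroup V] [Module ℝ V] (σ : PointedCone ℝ V) : ℕ :=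
  Module.finrank ℝ (Submodule.span ℝ (σ : Set V))

/-- Integral equivalence of cones `σ ⊂ V` and `τ ⊂ W` with respect to lattices `Λ ⊂ V` and
`Γ ⊂ W`: a linear isomorphism of the linear spans carries `Λ ∩ span σ` onto `Γ ∩ span τ`,
and `σ` onto `τ`. -/
def ConesEquivalent {V W : Type*} [AddCommGroup V] [Module ℝ V] [AddCommGroup W] [Module ℝ W]
    (Λ : Set V) (σ : PointedCone ℝ V) (Γ : Set W) (τ : PointedCone ℝ W) : Prop :=
  ∃ f : Submodule.span ℝ (σ : Set V) ≃ₗ[ℝ] Submodule.span ℝ (τ : Set W),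
    (∀ x : Submodule.span ℝ (σ : Set V), (x : V) ∈ Λ ↔ (f x : W) ∈ Γ) ∧
    (∀ x : Submodule.span ℝ (σ : Set V), (x : V) ∈ σ ↔ (f x : W) ∈ τ)

/-- The tangent cone `cone (u' - u | u' ∈ P)` of `P` at a point `u` of `P`, as a cone in the
linear space parallel to `aff P`. -/
def tangentCone {n : ℕ} (P : Set (Fin n → ℝ)) (u : Fin n → ℝ) : PointedCone ℝ (dirSpace P) :=
  PointedCone.hull ℝ {x : dirSpace P | u + (x : Fin n → ℝ) ∈ P}

/-- The normal cone of `P` at `u`: the dual of the tangent cone. It lives in the dual of the linear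
space parallel to `aff P` (for full-dimensional `P` this is the dual of `ℝⁿ`). -/
def normalCone {n : ℕ} (P : Set (Fin n → ℝ)) (u : Fin n → ℝ) :
    PointedCone ℝ (Module.Dual ℝ (dirSpace P)) :=
  PointedCone.dual (Module.Dual.eval ℝ (dirSpace P)) (tangentCone P u : Set (dirSpace P))

/-- The lattice in which normal cones live: the dual of the lattice of integer vectors
parallel to `aff P`. -/
def dualLattice {n : ℕ} (P : Set (Fin n → ℝ)) : Set (Module.Dual ℝ (dirSpace P)) :=
  {φ | ∀ x : dirSpace P, (x : Fin n → ℝ) ∈ intLattice n → ∃ k : ℤ, φ x = k}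

/-- Every normal cone of `P` (at a vertex of `P`) is integrally equivalent to a member of `F`. -/
def NormalConesIn {n : ℕ} (F : Set (Σ m : ℕ, PointedCone ℝ (Fin m → ℝ)))
    (P : Set (Fin n → ℝ)) : Prop :=
  ∀ u ∈ P.extremePoints ℝ, ∃ σ ∈ F,
    ConesEquivalent (dualLattice P) (normalCone P u) (intLattice σ.1) σ.2

/-- The lattice polytopes, in `ℝⁿ` for any `n`, that have exactly `k` lattice points and all whose
normal cones are integrally equivalent to cones in `F`. -/
def polytopesWith (k : ℕ) (F : Set (Σ m : ℕ, PointedCone ℝ (Fin m → ℝ))) :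
    Set (Σ n : ℕ, Set (Fin n → ℝ)) :=
  {P | IsLatticePolytope P.2 ∧ (P.2 ∩ intLattice P.1).encard = k ∧ NormalConesIn F P.2}

/-- The class `C` of polytopes contains only finitely many members up to integral equivalence. -/
def FinitelyManyUpToEquivalence (C : Set (Σ n : ℕ, Set (Fin n → ℝ))) : Prop :=
  ∃ T ⊆ C, T.Finite ∧ ∀ P ∈ C, ∃ Q ∈ T, IntegrallyEquivalent P.2 Q.2

end LatticePolytopes

/-! A full-dimensional tangent cone at a vertex is salient, and it is recovered with its lattice as
the dual of the normal cone. So a finite list of normal cones gives a finite list `T` of tangent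
cones in `ℝ^d`, where `d` is the dimension of some cone in the family (`exists_coordinates`,
`exists_finite_charts`). Lattice coordinates centred at a vertex make that vertex `0` and its
tangent cone a member of `T` on the nose. It remains to bound the number of such framed polytopes
with at most `K` lattice points (`finite_isFramed`).

The polytope is explored along its edges, keeping finite the set of possible pairs (vertex, tangent
cone there). Given `u` and its cone `C`, an edge vector is a lattice vector on one of finitely many
rays, and it is short because an edge contains few lattice points (`finite_shortVecs`). So the
neighbours `u' = u + v` are finitely many. The main point is that the cone at `u'`, known only up to
a unimodular map `A` onto some `τ ∈ T`, also takes finitely many values (`finite_next_of_edge`).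

Modulo the line of `v` the cones at `u` and `u'` have the same image, so enough edges at `u'` to
span, together with `-v`, have the form `w' - u' = a • (w - u) + b • v` with `a > 0` and `w` a
neighbour of `u` (`dirCone_le_span_parallel`). Integrality of `A (w - u)`, measured against the
finitely many short vectors of `τ`, bounds `a`. Rows of lattice points parallel to `v` then bound
`b` (`norm_parallel_edge_le`). Hence `A` sends a spanning subset of a fixed finite set into a fixed
finite set, which leaves finitely many `A`.

The edge graph is connected (`reach_eq`) and there are at most `K` vertices, so `K` steps reach
every vertex, and the polytope is the hull of its vertices. -/

namespace LatticePolytopes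

/-! ### Salient cones and their extreme rays -/

section Cones

variable {V : Type*} [AddCommGroup V] [Module ℝ V]

/-- A cone is salient if it contains no line. -/
def IsSalient (C : PointedCone ℝ V) : Prop := ∀ x ∈ C, -x ∈ C → x = 0

/-- A nonzero vector spans an extreme ray of `C` if all its decompositions in `C` are parallel
to it. -/
def IsExtremeVec (C : PointedCone ℝ V) (v : V) : Prop :=
  v ∈ C ∧ v ≠ 0 ∧ ∀ x ∈ C, ∀ y ∈ C, x + y = v → ∃ a : ℝ, x = a • v

lemma smul_mem_cone {C : PointedCone ℝ V} {x : V} (hx : x ∈ C) {a : ℝ} (ha : 0 ≤ a) :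
    a • x ∈ C := C.smul_mem ha hx

lemma mem_hull_finset {S : Finset V} {x : V} :
    x ∈ PointedCone.hull ℝ (S : Set V) ↔
      ∃ c : V → ℝ, (∀ s ∈ S, 0 ≤ c s) ∧ ∑ s ∈ S, c s • s = x := by
  constructor
  · intro h
    obtain ⟨c, -, hc⟩ := Submodule.mem_span_finset.1 h
    exact ⟨fun s => (c s : ℝ), fun s _ => (c s).2, hc⟩
  · rintro ⟨c, hc, rfl⟩
    exact Submodule.sum_mem _ fun s hs =>
      smul_mem_cone (PointedCone.subset_hull hs) (hc s hs)

lemma IsSalient.eq_zero_of_add {C : PointedCone ℝ V} (hC : IsSalient C) {x y : V} (hx : x ∈ C)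
    (hy : y ∈ C) (h : x + y = 0) : x = 0 :=
  hC x hx (by rwa [neg_eq_of_add_eq_zero_right h])

lemma IsSalient.eq_zero_of_sum {C : PointedCone ℝ V} (hC : IsSalient C) {ι : Type*} {s : Finset ι}
    {f : ι → V} (hf : ∀ i ∈ s, f i ∈ C) (h : ∑ i ∈ s, f i = 0) : ∀ i ∈ s, f i = 0 := by
  classical
  intro i hi
  rw [← Finset.add_sum_erase s f hi] at h
  exact hC.eq_zero_of_add (hf i hi)
    (Submodule.sum_mem _ fun j hj => hf j (Finset.mem_of_mem_erase hj)) h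

lemma IsSalient.nonneg_of_smul_mem {C : PointedCone ℝ V} (hC : IsSalient C) {v : V} (hv : v ∈ C)
    (hv0 : v ≠ 0) {a : ℝ} (h : a • v ∈ C) : 0 ≤ a := by
  by_contra ha
  push Not at ha
  have h1 := hC.eq_zero_of_add h (smul_mem_cone hv (neg_nonneg.2 ha.le)) (by simp)
  rcases smul_eq_zero.1 h1 with h2 | h2
  · exact ha.ne h2
  · exact hv0 h2

lemma IsExtremeVec.smul {C : PointedCone ℝ V} {v : V} (hv : IsExtremeVec C v) {a : ℝ}
    (ha : 0 < a) : IsExtremeVec C (a • v) := by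
  refine ⟨smul_mem_cone hv.1 ha.le, smul_ne_zero ha.ne' hv.2.1, fun x hx y hy h => ?_⟩
  obtain ⟨b, hb⟩ := hv.2.2 (a⁻¹ • x) (smul_mem_cone hx (inv_nonneg.2 ha.le)) (a⁻¹ • y)
    (smul_mem_cone hy (inv_nonneg.2 ha.le)) (by
      rw [← smul_add, h, smul_smul, inv_mul_cancel₀ ha.ne', one_smul])
  refine ⟨b, ?_⟩
  rw [smul_comm, ← hb, smul_smul, mul_inv_cancel₀ ha.ne', one_smul]

/-- If a generator of a salient cone is not extreme then it is redundant. -/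
lemma mem_hull_erase [DecidableEq V] {S : Finset V}
    (hS : IsSalient (PointedCone.hull ℝ (S : Set V))) {v : V} (hvS : v ∈ S)
    (hv : ¬ IsExtremeVec (PointedCone.hull ℝ (S : Set V)) v) :
    v ∈ PointedCone.hull ℝ ((S.erase v : Finset V) : Set V) := by
  by_cases hv0 : v = 0
  · rw [hv0]; exact Submodule.zero_mem _
  have hvC : v ∈ PointedCone.hull ℝ (S : Set V) := PointedCone.subset_hull hvS
  simp only [IsExtremeVec, not_and, not_forall] at hv
  obtain ⟨x, hx, y, hy, hxy, hne⟩ := hv hvC hv0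
  obtain ⟨a, ha, rfl⟩ := mem_hull_finset.1 hx
  obtain ⟨b, hb, rfl⟩ := mem_hull_finset.1 hy
  have hmem : ∀ c : V → ℝ, (∀ s ∈ S, 0 ≤ c s) →
      ∑ s ∈ S.erase v, c s • s ∈ PointedCone.hull ℝ ((S.erase v : Finset V) : Set V) :=
    fun c hc => mem_hull_finset.2 ⟨c, fun s hs => hc s (Finset.mem_of_mem_erase hs), rfl⟩
  have hle : PointedCone.hull ℝ ((S.erase v : Finset V) : Set V) ≤
      PointedCone.hull ℝ (S : Set V) :=
    Submodule.span_mono (by exact_mod_cast Finset.erase_subset v S)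
  rw [← Finset.add_sum_erase S _ hvS, ← Finset.add_sum_erase S (fun s => b s • s) hvS] at hxy
  have hrest : ∑ s ∈ S.erase v, a s • s + ∑ s ∈ S.erase v, b s • s = (1 - (a v + b v)) • v := by
    generalize ∑ s ∈ S.erase v, a s • s = p at *
    generalize ∑ s ∈ S.erase v, b s • s = q at *
    calc p + q = (a v • v + p + (b v • v + q)) - (a v + b v) • v := by module
      _ = (1 - (a v + b v)) • v := by rw [hxy]; module
  -- Compare the total coefficient of `v` in `x + y = v` with 1. Below 1, solve for `v` in terms of
  -- the other generators. Otherwise salience kills the remaining terms of `x`, making it parallel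
  -- to `v`, against the choice of `x`.
  rcases lt_or_ge (a v + b v) 1 with h1 | h1
  · have h2 : v = (1 - (a v + b v))⁻¹ • ((1 - (a v + b v)) • v) := by
      rw [smul_smul, inv_mul_cancel₀ (sub_pos.2 h1).ne', one_smul]
    have h3 := smul_mem_cone (Submodule.add_mem _ (hmem a ha) (hmem b hb))
      (inv_nonneg.2 (sub_pos.2 h1).le)
    rwa [hrest, ← h2] at h3
  · exfalso
    have h2 : ∑ s ∈ S.erase v, a s • s +
        (∑ s ∈ S.erase v, b s • s + (a v + b v - 1) • v) = 0 := by
      rw [← add_assoc, hrest, ← add_smul]; simp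
    have h3 := hS.eq_zero_of_add (hle (hmem a ha)) (Submodule.add_mem _ (hle (hmem b hb))
      (smul_mem_cone hvC (by linarith))) h2
    apply hne
    refine ⟨a v, ?_⟩
    rw [← Finset.add_sum_erase S _ hvS, h3, add_zero]

/-- A salient cone is generated by the extreme members of any finite generating set. -/
lemma hull_extreme {S : Finset V} (hS : IsSalient (PointedCone.hull ℝ (S : Set V))) :
    PointedCone.hull ℝ {s ∈ (S : Set V) | IsExtremeVec (PointedCone.hull ℝ (S : Set V)) s} =
      PointedCone.hull ℝ (S : Set V) := by
  classical
  -- Non-extreme generators are discarded one at a time; the induction is over subsets `R` still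
  -- generating the whole cone.
  suffices h : ∀ n : ℕ, ∀ R : Finset V, R.card = n → R ⊆ S →
      PointedCone.hull ℝ (R : Set V) = PointedCone.hull ℝ (S : Set V) →
      PointedCone.hull ℝ (S : Set V) ≤
      PointedCone.hull ℝ {s ∈ (S : Set V) | IsExtremeVec (PointedCone.hull ℝ (S : Set V)) s} from
    le_antisymm (Submodule.span_mono fun s hs => hs.1) (h _ S rfl subset_rfl rfl)
  intro n
  induction n with
  | zero =>
    intro R hR hRS hRC
    rw [← hRC, Finset.card_eq_zero.1 hR]
    exact Submodule.span_mono (by simp)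
  | succ n ih =>
    intro R hR hRS hRC
    by_cases hall : ∀ v ∈ R, IsExtremeVec (PointedCone.hull ℝ (S : Set V)) v
    · conv_lhs => rw [← hRC]
      exact Submodule.span_mono fun s hs => ⟨hRS hs, hall s hs⟩
    · push Not at hall
      obtain ⟨v, hvR, hv⟩ := hall
      refine ih (R.erase v) (by rw [Finset.card_erase_of_mem hvR, hR]; rfl)
        ((Finset.erase_subset v R).trans hRS) ?_
      rw [← hRC]
      refine le_antisymm (Submodule.span_mono (by exact_mod_cast Finset.erase_subset v R))
        (Submodule.span_le.2 fun s hs => ?_)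
      by_cases hsv : s = v
      · rw [hsv]
        exact mem_hull_erase (by rwa [hRC]) hvR (by rwa [hRC])
      · exact PointedCone.subset_hull (Finset.mem_coe.2 (Finset.mem_erase.2 ⟨hsv, hs⟩))

/-- Every extreme ray of a salient cone contains a member of any finite generating set. -/
lemma IsExtremeVec.exists_generator {S : Finset V}
    (hS : IsSalient (PointedCone.hull ℝ (S : Set V))) {v : V}
    (hv : IsExtremeVec (PointedCone.hull ℝ (S : Set V)) v) :
    ∃ s ∈ S, ∃ a : ℝ, 0 < a ∧ s = a • v := by
  classical
  obtain ⟨c, hc, hcv⟩ := mem_hull_finset.1 hv.1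
  have hmem : ∀ s ∈ S, c s • s ∈ PointedCone.hull ℝ (S : Set V) := fun s hs =>
    smul_mem_cone (PointedCone.subset_hull hs) (hc s hs)
  -- Any nonzero term of an expression of `v` in the generators must be parallel to `v`; salience
  -- fixes the sign.
  obtain ⟨s, hs, hs0⟩ : ∃ s ∈ S, c s • s ≠ 0 := by
    by_contra! h
    exact hv.2.1 (by rw [← hcv, Finset.sum_eq_zero h])
  obtain ⟨b, hb⟩ := hv.2.2 (c s • s) (hmem s hs) (∑ t ∈ S.erase s, c t • t)
    (Submodule.sum_mem _ fun t ht => hmem t (Finset.mem_of_mem_erase ht))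
    (by rw [Finset.add_sum_erase S (fun t => c t • t) hs, hcv])
  have hb0 : 0 ≤ b := hS.nonneg_of_smul_mem hv.1 hv.2.1 (hb ▸ hmem s hs)
  have hb1 : b ≠ 0 := by rintro rfl; exact hs0 (by rw [hb, zero_smul])
  have hc1 : c s ≠ 0 := by intro h; exact hs0 (by rw [h, zero_smul])
  refine ⟨s, hs, (c s)⁻¹ * b, mul_pos (inv_pos.2 ((hc s hs).lt_of_ne' hc1))
    (hb0.lt_of_ne' hb1), ?_⟩
  rw [mul_smul, ← hb, smul_smul, inv_mul_cancel₀ hc1, one_smul]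

end Cones

/-- A point outside a finitely generated salient cone is separated from it. -/
lemma exists_dual_neg {V : Type*} [NormedAddCommGroup V] [NormedSpace ℝ V] {S : Finset V}
    (hS : IsSalient (PointedCone.hull ℝ (S : Set V))) {x : V}
    (hx : x ∉ PointedCone.hull ℝ (S : Set V)) :
    ∃ c : V →L[ℝ] ℝ, (∀ s ∈ S, 0 ≤ c s) ∧ c x < 0 := by
  classical
  set R : Finset V := S.filter (· ≠ 0)
  have hRS : R ⊆ S := Finset.filter_subset _ _
  -- A convex combination equal to 0 would put `x` in the cone if `-x` has positive weight, and
  -- contradict salience otherwise. The hull is compact, so Hahn–Banach gives a functional positive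
  -- on `-x` and on all nonzero generators.
  have h0 : (0 : V) ∉ convexHull ℝ ((insert (-x) R : Finset V) : Set V) := by
    rw [Finset.mem_convexHull']
    rintro ⟨w, hw, hw1, hw0⟩
    have key : ∀ w : V → ℝ, (∀ y ∈ R, 0 ≤ w y) → ∑ y ∈ R, w y • y = 0 → ∑ y ∈ R, w y = 0 := by
      intro w hw hw0
      refine Finset.sum_eq_zero fun y hy => ?_
      have := hS.eq_zero_of_sum (fun y hy => smul_mem_cone
        (PointedCone.subset_hull (hRS hy)) (hw y hy)) hw0 y hy
      exact (smul_eq_zero.1 this).resolve_right (Finset.mem_filter.1 hy).2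
    by_cases hxR : -x ∈ R
    · rw [Finset.insert_eq_of_mem hxR] at hw hw1 hw0
      linarith [key w hw hw0]
    · rw [Finset.sum_insert hxR] at hw1 hw0
      have hwR : ∀ y ∈ R, 0 ≤ w y := fun y hy => hw y (Finset.mem_insert_of_mem hy)
      rcases (hw (-x) (Finset.mem_insert_self _ _)).eq_or_lt with h | h
      · rw [← h] at hw1 hw0
        simp only [zero_smul, zero_add] at hw1 hw0
        linarith [key w hwR hw0]
      · apply hx
        have h2 : x = (w (-x))⁻¹ • ∑ y ∈ R, w y • y := by
          have h3 : ∑ y ∈ R, w y • y = w (-x) • x := by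
            rw [smul_neg, neg_add_eq_zero] at hw0
            exact hw0.symm
          rw [h3, smul_smul, inv_mul_cancel₀ h.ne', one_smul]
        rw [h2]
        exact smul_mem_cone (Submodule.sum_mem _ fun y hy => smul_mem_cone
          (PointedCone.subset_hull (hRS hy)) (hwR y hy)) (inv_nonneg.2 h.le)
  obtain ⟨c, u, hu, hc⟩ := geometric_hahn_banach_point_closed (convex_convexHull ℝ _)
    ((Set.Finite.isCompact_convexHull ℝ (Finset.finite_toSet _)).isClosed) h0
  rw [map_zero] at hu
  refine ⟨c, fun s hs => ?_, ?_⟩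
  · by_cases hs0 : s = 0
    · simp [hs0]
    · exact (hu.trans (hc s (subset_convexHull ℝ _ (Finset.mem_coe.2 (Finset.mem_insert_of_mem
        (Finset.mem_filter.2 ⟨hs, hs0⟩)))))).le
  · have := hu.trans (hc (-x) (subset_convexHull ℝ _ (Finset.mem_coe.2
      (Finset.mem_insert_self _ _))))
    rw [map_neg] at this
    linarith

/-! ### Tangent cones and edges of polytopes -/

section DirCones

variable {V : Type*} [AddCommGroup V] [Module ℝ V]

/-- The tangent cone of `P` at `u` inside the ambient space. -/
def dirCone (P : Set V) (u : V) : PointedCone ℝ V := PointedCone.hull ℝ {x | u + x ∈ P}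

lemma sub_mem_dirCone {P : Set V} {u p : V} (hp : p ∈ P) : p - u ∈ dirCone P u :=
  PointedCone.subset_hull (by simpa using hp)

lemma mem_dirCone {P : Set V} (hP : Convex ℝ P) {u : V} (hu : u ∈ P) {x : V} :
    x ∈ dirCone P u ↔ ∃ t : ℝ, 0 ≤ t ∧ ∃ p ∈ P, x = t • (p - u) := by
  constructor
  · intro h
    induction h using Submodule.span_induction with
    | mem x hx => exact ⟨1, zero_le_one, u + x, hx, by simp⟩
    | zero => exact ⟨0, le_rfl, u, hu, by simp⟩
    | add x y _ _ hx hy =>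
      obtain ⟨t, ht, p, hp, rfl⟩ := hx
      obtain ⟨s, hs, q, hq, rfl⟩ := hy
      rcases (add_nonneg ht hs).eq_or_lt with h0 | h0
      · have h1 : t = 0 := by linarith
        have h2 : s = 0 := by linarith
        exact ⟨0, le_rfl, u, hu, by simp [h1, h2]⟩
      · refine ⟨t + s, h0.le, (t / (t + s)) • p + (s / (t + s)) • q,
          hP hp hq (by positivity) (by positivity) (by field_simp), ?_⟩
        have h1 : (t + s) * (t / (t + s)) = t := by field_simp
        have h2 : (t + s) * (s / (t + s)) = s := by field_simp
        rw [smul_sub (t + s), smul_add, smul_smul, smul_smul, h1, h2]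
        module
    | smul a x _ hx =>
      obtain ⟨t, ht, p, hp, rfl⟩ := hx
      exact ⟨a * t, mul_nonneg a.2 ht, p, hp, by rw [mul_smul]; rfl⟩
  · rintro ⟨t, ht, p, hp, rfl⟩
    exact smul_mem_cone (sub_mem_dirCone hp) ht

/-- Opposite nonzero directions in the cone come from points `p`, `q` of `P` on either side of `u`,
placing `u` inside a segment of `P`. -/
lemma isSalient_dirCone {P : Set V} (hP : Convex ℝ P) {u : V} (hu : u ∈ P.extremePoints ℝ) :
    IsSalient (dirCone P u) := by
  intro x hx hx'
  obtain ⟨t, ht, p, hp, rfl⟩ := (mem_dirCone hP hu.1).1 hx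
  obtain ⟨s, hs, q, hq, h⟩ := (mem_dirCone hP hu.1).1 hx'
  by_contra h0
  have ht0 : 0 < t := ht.lt_of_ne' (by rintro rfl; exact h0 (zero_smul _ _))
  have hs0 : 0 < s := hs.lt_of_ne' (by rintro rfl; exact h0 (by simpa using h))
  have hu' : u ∈ openSegment ℝ p q := by
    refine ⟨t / (t + s), s / (t + s), by positivity, by positivity, by field_simp, ?_⟩
    have h1 : t • p + s • q = (t + s) • u := by
      rw [neg_eq_iff_add_eq_zero] at h
      rw [← sub_eq_zero, ← h]
      module
    rw [div_eq_inv_mul, div_eq_inv_mul, mul_smul, mul_smul, ← smul_add, h1, smul_smul,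
      inv_mul_cancel₀ (by positivity), one_smul]
  have := ((mem_extremePoints.1 hu).2 p hp q hq hu').1
  exact h0 (by simp [this])

/-- `S` is the set of vertices of the polytope `P`. -/
structure IsVertexSet (P : Set V) (S : Finset V) : Prop where
  eq_hull : P = convexHull ℝ (S : Set V)
  mem_iff : ∀ x, x ∈ S ↔ x ∈ P.extremePoints ℝ

lemma IsVertexSet.convex {P : Set V} {S : Finset V} (h : IsVertexSet P S) : Convex ℝ P :=
  h.eq_hull ▸ convex_convexHull ℝ _

lemma IsVertexSet.mem {P : Set V} {S : Finset V} (h : IsVertexSet P S) {u : V} (hu : u ∈ S) :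
    u ∈ P := ((h.mem_iff u).1 hu).1

lemma dirCone_convexHull [DecidableEq V] (S : Finset V) (u : V) :
    dirCone (convexHull ℝ (S : Set V)) u =
      PointedCone.hull ℝ ((S.image (· - u) : Finset V) : Set V) := by
  apply le_antisymm
  · refine Submodule.span_le.2 fun x hx => ?_
    obtain ⟨w, hw, hw1, hwx⟩ := Finset.mem_convexHull'.1 hx
    have : x = ∑ y ∈ S, w y • (y - u) := by
      simp only [smul_sub, Finset.sum_sub_distrib, hwx, ← Finset.sum_smul, hw1, one_smul]
      simp
    rw [this]
    exact Submodule.sum_mem _ fun y hy => smul_mem_cone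
      (PointedCone.subset_hull (Finset.mem_coe.2 (Finset.mem_image_of_mem _ hy))) (hw y hy)
  · refine Submodule.span_le.2 fun x hx => ?_
    obtain ⟨s, hs, rfl⟩ := Finset.mem_image.1 (Finset.mem_coe.1 hx)
    exact sub_mem_dirCone (subset_convexHull ℝ _ hs)

lemma IsVertexSet.dirCone_eq [DecidableEq V] {P : Set V} {S : Finset V} (h : IsVertexSet P S)
    (u : V) : dirCone P u = PointedCone.hull ℝ ((S.image (· - u) : Finset V) : Set V) := by
  rw [← dirCone_convexHull, ← h.eq_hull]

/-- `u` and `w` are the end points of an edge of the polytope `P`. -/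
def IsEdge (P : Set V) (u w : V) : Prop :=
  u ∈ P.extremePoints ℝ ∧ w ∈ P.extremePoints ℝ ∧ IsExtremeVec (dirCone P u) (w - u)

/-- Rebasing a decomposition of `u - w` from `w` to `u` turns it into a decomposition of a multiple
of `w - u`. Salience at `u` makes the multiple nonnegative, and then salience or extremality at `u`
makes both summands parallel to the edge. -/
lemma IsEdge.symm {P : Set V} (hP : Convex ℝ P) {u w : V} (h : IsEdge P u w) : IsEdge P w u := by
  obtain ⟨hu, hw, -, hne, hext⟩ := h
  have hsu := isSalient_dirCone hP hu
  have hsw := isSalient_dirCone hP hw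
  refine ⟨hw, hu, sub_mem_dirCone hu.1, fun h0 => hne (by rw [← neg_sub, h0, neg_zero]), ?_⟩
  intro x hx y hy hxy
  obtain ⟨t, ht, p, hp, rfl⟩ := (mem_dirCone hP hw.1).1 hx
  obtain ⟨s, hs, q, hq, rfl⟩ := (mem_dirCone hP hw.1).1 hy
  have hpu := sub_mem_dirCone (u := u) hp
  have hqu := sub_mem_dirCone (u := u) hq
  have hwu := sub_mem_dirCone (u := u) hw.1
  have key : t • (p - u) + s • (q - u) = (t + s - 1) • (w - u) := by
    have : t • (p - u) + s • (q - u) =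
        (t • (p - w) + s • (q - w)) - (u - w) + (t + s - 1) • (w - u) := by module
    rw [this, hxy, sub_self, zero_add]
  rcases lt_or_ge (t + s) 1 with h1 | h1
  · exfalso
    have h2 : (1 - (t + s)) • (w - u) + (t • (p - u) + s • (q - u)) = 0 := by rw [key]; module
    have h3 := hsu.eq_zero_of_add (smul_mem_cone hwu (sub_nonneg.2 h1.le))
      (Submodule.add_mem _ (smul_mem_cone hpu ht) (smul_mem_cone hqu hs)) h2
    exact (smul_ne_zero (sub_pos.2 h1).ne' hne) h3
  · rcases ht.eq_or_lt with ht0 | ht0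
    · exact ⟨0, by rw [← ht0]; simp⟩
    have hpar : ∃ a : ℝ, t • (p - u) = a • (w - u) := by
      rcases h1.eq_or_lt with h2 | h2
      · refine ⟨0, ?_⟩
        rw [← h2, sub_self, zero_smul] at key
        rw [zero_smul]
        exact hsu.eq_zero_of_add (smul_mem_cone hpu ht) (smul_mem_cone hqu hs) key
      · have h3 : 0 < t + s - 1 := sub_pos.2 h2
        obtain ⟨a, ha⟩ := hext ((t + s - 1)⁻¹ • t • (p - u))
          (smul_mem_cone (smul_mem_cone hpu ht) (inv_nonneg.2 h3.le))
          ((t + s - 1)⁻¹ • s • (q - u))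
          (smul_mem_cone (smul_mem_cone hqu hs) (inv_nonneg.2 h3.le))
          (by rw [← smul_add, key, smul_smul, inv_mul_cancel₀ h3.ne', one_smul])
        refine ⟨(t + s - 1) * a, ?_⟩
        rw [mul_smul, ← ha, smul_smul, mul_inv_cancel₀ h3.ne', one_smul]
    obtain ⟨a, ha⟩ := hpar
    refine ⟨t - a, ?_⟩
    have : t • (p - w) = t • (p - u) - t • (w - u) := by module
    rw [this, ha]
    module

/-- The vertices that are joined to `u` by at most `k` edges of `P`. -/
def reach (P : Set V) (u : V) : ℕ → Set V
  | 0 => {u}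
  | k + 1 => reach P u k ∪ {w | ∃ x ∈ reach P u k, IsEdge P x w}

lemma reach_subset {P : Set V} {u : V} (hu : u ∈ P.extremePoints ℝ) (k : ℕ) :
    reach P u k ⊆ P.extremePoints ℝ := by
  induction k with
  | zero => exact Set.singleton_subset_iff.2 hu
  | succ k ih =>
    rintro w (hw | ⟨x, -, hw⟩)
    · exact ih hw
    · exact hw.2.1

/-- The vectors from `u` to the vertices generate the cone, and the extreme ones among them, which
suffice by `hull_extreme`, are the edges. -/
lemma IsVertexSet.dirCone_eq_hull_edges {P : Set V} {S : Finset V} (h : IsVertexSet P S)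
    {u : V} (hu : u ∈ P.extremePoints ℝ) :
    dirCone P u = PointedCone.hull ℝ {x | ∃ w, IsEdge P u w ∧ x = w - u} := by
  classical
  have hs := isSalient_dirCone h.convex hu
  apply le_antisymm
  · rw [h.dirCone_eq u] at hs ⊢
    rw [← hull_extreme hs]
    refine Submodule.span_mono fun x hx => ?_
    obtain ⟨w, hw, rfl⟩ := Finset.mem_image.1 (Finset.mem_coe.1 hx.1)
    exact ⟨w, ⟨hu, (h.mem_iff w).1 hw, by rw [h.dirCone_eq u]; exact hx.2⟩, rfl⟩
  · refine Submodule.span_le.2 ?_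
    rintro x ⟨w, hw, rfl⟩
    exact hw.2.2.1

/-- Modulo an edge `[u, u']`, the edges at `u'` that are parallel to edges at `u` span
the tangent cone. -/
lemma IsVertexSet.dirCone_le_span_parallel {P : Set V} {S : Finset V} (h : IsVertexSet P S)
    {u u' : V} (huu : IsEdge P u u') :
    (dirCone P u : Set V) ⊆ Submodule.span ℝ (insert (u - u')
      {x | ∃ w', IsEdge P u' w' ∧ x = w' - u' ∧ ∃ w, IsEdge P u w ∧
        (∀ a : ℝ, w - u ≠ a • (u' - u)) ∧
        ∃ a b : ℝ, 0 < a ∧ w' - u' = a • (w - u) + b • (u' - u)}) := by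
  classical
  set v := u' - u with hv
  set H : Set V := _
  change _ ⊆ ((Submodule.span ℝ (insert (u - u') H) : Submodule ℝ V) : Set V)
  obtain ⟨hu, hu', hv1, hv0, hext⟩ := id huu
  have hs := isSalient_dirCone h.convex hu
  set q : V →ₗ[ℝ] V ⧸ Submodule.span ℝ {v} := Submodule.mkQ _ with hq
  have hqker : ∀ x, q x = 0 ↔ ∃ a : ℝ, a • v = x := fun x => by
    rw [hq, Submodule.mkQ_apply, Submodule.Quotient.mk_eq_zero, Submodule.mem_span_singleton]
  have hedges : ∀ u ∈ P.extremePoints ℝ, ∃ R : Finset V,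
      (∀ x ∈ R, ∃ w, IsEdge P u w ∧ x = w - u) ∧
      PointedCone.hull ℝ (R : Set V) = dirCone P u := by
    intro u hu
    refine ⟨(S.filter fun w => IsEdge P u w).image (· - u), fun x hx => ?_, ?_⟩
    · obtain ⟨w, hw, rfl⟩ := Finset.mem_image.1 hx
      exact ⟨w, (Finset.mem_filter.1 hw).2, rfl⟩
    · rw [h.dirCone_eq_hull_edges hu]
      congr 1
      ext x
      simp only [Finset.coe_image, Finset.coe_filter, Set.mem_image, Set.mem_ofPred_eq]
      constructor
      · rintro ⟨w, hw, rfl⟩; exact ⟨w, hw.2, rfl⟩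
      · rintro ⟨w, hw, rfl⟩; exact ⟨w, ⟨(h.mem_iff w).2 hw.2.1, hw⟩, rfl⟩
  have hmap : ∀ R : Finset V, PointedCone.hull ℝ ((R.image q : Finset _) : Set _) =
      (PointedCone.hull ℝ (R : Set V)).map q := by
    intro R
    rw [Finset.coe_image]
    exact (Submodule.map_span (q.restrictScalars {c : ℝ // 0 ≤ c}) (R : Set V)).symm
  -- The generators `w - u` and `w - u'` differ by `v`, which `q` kills.
  have hsame : (dirCone P u).map q = (dirCone P u').map q := by
    rw [h.dirCone_eq u, h.dirCone_eq u', ← hmap, ← hmap]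
    congr 2
    rw [Finset.image_image, Finset.image_image]
    refine Finset.image_congr fun w _ => ?_
    have : q (w - u) = q (w - u') + q v := by rw [← map_add]; congr 1; simp only [hv]; abel
    simp only [Function.comp_apply]
    rw [this, (hqker v).2 ⟨1, one_smul _ _⟩, add_zero]
  -- Opposite images lift to `x + x' = a • v`. For `a ≤ 0` salience upstairs gives `x = 0`; for `a >
  -- 0` extremality of `v` puts `x` on the killed line.
  have hsal : IsSalient ((dirCone P u).map q) := by
    intro y hy hy'
    obtain ⟨x, hx, rfl⟩ := PointedCone.mem_map.1 hy
    obtain ⟨x', hx', hxx⟩ := PointedCone.mem_map.1 hy'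
    obtain ⟨a, ha⟩ := (hqker (x + x')).1 (by rw [map_add, hxx, add_neg_cancel])
    rcases le_or_gt a 0 with h0 | h0
    · have h1 : x + (x' + (-a) • v) = 0 := by rw [← add_assoc, ← ha]; module
      rw [hs.eq_zero_of_add hx (Submodule.add_mem _ hx' (smul_mem_cone hv1
        (neg_nonneg.2 h0))) h1, map_zero]
    · obtain ⟨b, hb⟩ := (IsExtremeVec.smul (C := dirCone P u) ⟨hv1, hv0, hext⟩ h0).2.2
        x hx x' hx' ha.symm
      exact (hqker x).2 ⟨b * a, by rw [hb, mul_smul]⟩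
  obtain ⟨R, hR, hRC⟩ := hedges u hu
  obtain ⟨R', hR', hRC'⟩ := hedges u' hu'
  have hC1 := hmap R
  have hC2 := hmap R'
  rw [hRC] at hC1
  rw [hRC', ← hsame] at hC2
  have hgen := hull_extreme (S := R.image q) (by rwa [hC1])
  have hvspan : v ∈ Submodule.span ℝ (insert (u - u') H) := by
    have : u - u' ∈ Submodule.span ℝ (insert (u - u') H) :=
      Submodule.subset_span (Set.mem_insert _ _)
    have h2 := Submodule.neg_mem _ this
    rwa [neg_sub] at h2
  have hsub : (dirCone P u).map q ≤
      (PointedCone.ofSubmodule ((Submodule.span ℝ (insert (u - u') H)).map q)) := by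
    rw [← hC1, ← hgen]
    refine Submodule.span_le.2 ?_
    rintro y ⟨hy, hyext⟩
    obtain ⟨g, hg, rfl⟩ := Finset.mem_image.1 (Finset.mem_coe.1 hy)
    obtain ⟨w, hw, rfl⟩ := hR g hg
    rw [hC1, ← hC2] at hyext
    -- The common image is generated by edges at `u` and also by edges at `u'`, so each of its
    -- extreme rays carries an edge of both kinds.
    obtain ⟨s, hs', a, ha, hsa⟩ := hyext.exists_generator (by rwa [hC2])
    obtain ⟨g', hg', rfl⟩ := Finset.mem_image.1 hs'
    obtain ⟨w', hw', rfl⟩ := hR' g' hg'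
    obtain ⟨b, hb⟩ := (hqker (w' - u' - a • (w - u))).1 (by rw [map_sub, hsa, map_smul, sub_self])
    have hH : w' - u' ∈ H := ⟨w', hw', rfl, w, hw, fun c hc => hyext.2.1 ((hqker _).2 ⟨c, hc.symm⟩),
      a, b, ha, by rw [hb]; abel⟩
    refine ⟨a⁻¹ • (w' - u'), Submodule.smul_mem _ _
      (Submodule.subset_span (Set.mem_insert_of_mem _ hH)), ?_⟩
    rw [map_smul, hsa, smul_smul, inv_mul_cancel₀ ha.ne', one_smul]
  intro x hx
  obtain ⟨y, hy, hyx⟩ := hsub (PointedCone.mem_map.2 ⟨x, hx, rfl⟩)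
  obtain ⟨a, ha⟩ := (hqker (x - y)).1 (by rw [map_sub, hyx, sub_self])
  have : x = a • v + y := by rw [ha]; abel
  rw [this]
  exact Submodule.add_mem _ (Submodule.smul_mem _ _ hvspan) hy

end DirCones

/-! ### Connectedness of the edge graph -/

section Reach

variable {V : Type*} [NormedAddCommGroup V] [NormedSpace ℝ V]

/-- A set of vertices that is closed under passing to neighbours consists of all vertices. -/
lemma IsVertexSet.subset_of_closed {P : Set V} {S : Finset V} (h : IsVertexSet P S)
    {R : Set V} (hRS : R ⊆ P.extremePoints ℝ) {u : V} (hu : u ∈ R)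
    (hR : ∀ x ∈ R, ∀ w, IsEdge P x w → w ∈ R) : P.extremePoints ℝ ⊆ R := by
  intro w hw
  have hRfin : R.Finite := (Finset.finite_toSet S).subset fun x hx => (h.mem_iff x).2 (hRS hx)
  suffices hwR : w ∈ convexHull ℝ R by
    have hsub : convexHull ℝ R ⊆ P := convexHull_min (fun x hx => (hRS hx).1) h.convex
    exact extremePoints_convexHull_subset
      (inter_extremePoints_subset_extremePoints_of_subset hsub ⟨hwR, hw⟩)
  by_contra hwR
  obtain ⟨c, a, hca, haw⟩ := geometric_hahn_banach_closed_point (convex_convexHull ℝ R)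
    (hRfin.isCompact_convexHull ℝ).isClosed hwR
  -- As in the simplex method: a vertex maximizing `c` over `R` is a local maximum along its edges,
  -- hence a maximum over all of `P`.
  obtain ⟨x, hxR, hx⟩ := Set.exists_max_image R c hRfin ⟨u, hu⟩
  have hcone : ∀ y ∈ dirCone P x, c y ≤ 0 := by
    rw [h.dirCone_eq_hull_edges (hRS hxR)]
    intro y hy
    induction hy using Submodule.span_induction with
    | mem y hy =>
      obtain ⟨z, hz, rfl⟩ := hy
      rw [map_sub]
      linarith [hx z (hR x hxR z hz)]
    | zero => simp
    | add y z _ _ hy hz => rw [map_add]; linarith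
    | smul t y _ hy =>
      have : c (t • y) = (t : ℝ) * c y := by
        rw [← smul_eq_mul, ← map_smul]; rfl
      rw [this]
      exact mul_nonpos_of_nonneg_of_nonpos t.2 hy
  have h1 := hcone _ (sub_mem_dirCone hw.1)
  rw [map_sub] at h1
  have h2 := hca x (subset_convexHull ℝ R hxR)
  linarith

/-- The edge graph of a polytope is connected. -/
lemma IsVertexSet.reach_eq {P : Set V} {S : Finset V} (h : IsVertexSet P S)
    {u : V} (hu : u ∈ P.extremePoints ℝ) {k : ℕ} (hk : S.card ≤ k) :
    reach P u k = P.extremePoints ℝ := by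
  have hS : (S : Set V) = P.extremePoints ℝ := Set.ext fun x => h.mem_iff x
  have hfin : (P.extremePoints ℝ).Finite := hS ▸ Finset.finite_toSet S
  have hmono : ∀ k, reach P u k ⊆ reach P u (k + 1) := fun k => Set.subset_union_left
  have hmem : ∀ k, u ∈ reach P u k := fun k => by
    induction k with
    | zero => rfl
    | succ k ih => exact hmono k ih
  -- Until everything is reached, each step gains at least one vertex.
  have key : ∀ k, reach P u k = P.extremePoints ℝ ∨ k + 1 ≤ (reach P u k).ncard := by
    intro k
    induction k with
    | zero => right; simp [reach]
    | succ k ih =>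
      rcases ih with ih | ih
      · left
        exact (reach_subset hu _).antisymm (ih ▸ hmono k)
      · by_cases heq : reach P u (k + 1) = reach P u k
        · left
          rw [heq]
          refine (reach_subset hu _).antisymm (h.subset_of_closed (reach_subset hu _) (hmem k) ?_)
          intro x hx w hw
          rw [← heq]
          exact Or.inr ⟨x, hx, hw⟩
        · right
          have := Set.ncard_lt_ncard ((hmono k).ssubset_of_ne (Ne.symm heq))
            (hfin.subset (reach_subset hu _))
          omega
  rcases key k with h1 | h1
  · exact h1
  · have h2 := Set.ncard_le_ncard (reach_subset hu k) hfin
    rw [← hS, Set.ncard_coe_finset] at h2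
    omega

end Reach

/-! ### Lattice points, short extreme vectors and vertices -/

section Lattice

variable {n : ℕ}

lemma mem_intLattice {x : Fin n → ℝ} : x ∈ intLattice n ↔ ∀ i, ∃ k : ℤ, x i = k := by
  constructor
  · rintro ⟨z, rfl⟩ i
    exact ⟨z i, rfl⟩
  · intro h
    choose z hz using h
    exact ⟨z, funext fun i => (hz i).symm⟩

lemma zero_mem_intLattice : (0 : Fin n → ℝ) ∈ intLattice n := ⟨0, by ext; simp⟩

lemma add_mem_intLattice {x y : Fin n → ℝ} (hx : x ∈ intLattice n) (hy : y ∈ intLattice n) :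
    x + y ∈ intLattice n := by
  obtain ⟨a, rfl⟩ := hx
  obtain ⟨b, rfl⟩ := hy
  exact ⟨a + b, by ext; simp⟩

lemma neg_mem_intLattice {x : Fin n → ℝ} (hx : x ∈ intLattice n) : -x ∈ intLattice n := by
  obtain ⟨a, rfl⟩ := hx
  exact ⟨-a, by ext; simp⟩

lemma sub_mem_intLattice {x y : Fin n → ℝ} (hx : x ∈ intLattice n) (hy : y ∈ intLattice n) :
    x - y ∈ intLattice n :=
  sub_eq_add_neg x y ▸ add_mem_intLattice hx (neg_mem_intLattice hy)

lemma zsmul_mem_intLattice {x : Fin n → ℝ} (hx : x ∈ intLattice n) (k : ℤ) :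
    (k : ℝ) • x ∈ intLattice n := by
  obtain ⟨a, rfl⟩ := hx
  exact ⟨k • a, by ext; simp⟩

lemma finite_intLattice_norm_le (r : ℝ) : {x ∈ intLattice n | ‖x‖ ≤ r}.Finite := by
  refine ((Set.finite_Icc (fun _ : Fin n => ⌊-r⌋) (fun _ => ⌈r⌉)).image
    (fun (z : Fin n → ℤ) (i : Fin n) => (z i : ℝ))).subset ?_
  rintro x ⟨⟨z, rfl⟩, hz⟩
  refine ⟨z, ⟨fun i => ?_, fun i => ?_⟩, rfl⟩
  · have h := abs_le.1 ((norm_le_pi_norm (fun i => (z i : ℝ)) i).trans hz)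
    exact_mod_cast (Int.floor_le (-r)).trans h.1
  · have h := abs_le.1 ((norm_le_pi_norm (fun i => (z i : ℝ)) i).trans hz)
    exact_mod_cast h.2.trans (Int.le_ceil r)

/-- A convex set with at most `K` lattice points contains only short pieces of lattice lines. -/
lemma abs_le_of_mem_row {P : Set (Fin n → ℝ)} (hP : Convex ℝ P) {K : ℕ}
    (hK : (P ∩ intLattice n).encard ≤ K) {p v : Fin n → ℝ} (hp : p ∈ P) (hpL : p ∈ intLattice n)
    (hv : v ∈ intLattice n) (hv0 : v ≠ 0) {t : ℝ} (ht : p + t • v ∈ P) : |t| ≤ K := by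
  wlog ht0 : 0 ≤ t generalizing t v
  · rw [← abs_neg]
    exact this (neg_mem_intLattice hv) (neg_ne_zero.2 hv0) (t := -t) (by simpa using ht)
      (by linarith)
  rw [abs_of_nonneg ht0]
  by_contra! h
  have htpos : 0 < t := lt_of_le_of_lt (Nat.cast_nonneg K) h
  -- The points `p, p + v, …, p + K • v` would be `K + 1` lattice points of `P`.
  have hsub : (fun k : ℕ => p + (k : ℝ) • v) '' (Finset.range (K + 1) : Set ℕ) ⊆
      P ∩ intLattice n := by
    rintro _ ⟨k, hk, rfl⟩
    have hk' : (k : ℝ) ≤ K := by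
      exact_mod_cast Nat.lt_succ_iff.1 (Finset.mem_range.1 (Finset.mem_coe.1 hk))
    refine ⟨?_, add_mem_intLattice hpL (by exact_mod_cast zsmul_mem_intLattice hv k)⟩
    have h1 := hP.add_smul_mem hp ht (t := k / t)
      ⟨by positivity, (div_le_one htpos).2 (by linarith)⟩
    rwa [smul_smul, div_mul_cancel₀ _ htpos.ne'] at h1
  have hinj : Function.Injective fun k : ℕ => p + (k : ℝ) • v := by
    intro a b hab
    have := smul_left_injective ℝ hv0 (add_left_cancel hab)
    exact_mod_cast this
  have h2 := (Set.encard_le_encard hsub).trans hK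
  rw [hinj.encard_image, Set.encard_coe_eq_coe_finsetCard, Finset.card_range] at h2
  have h3 : K + 1 ≤ K := by exact_mod_cast h2
  omega

/-- The coefficient of `b` in a lattice point of the plane spanned by `a` and `b` is bounded away
from zero. -/
lemma exists_coeff_bound {a b : Fin n → ℝ} (ha : a ∈ intLattice n) (ha0 : a ≠ 0)
    (hab : ∀ c : ℝ, b ≠ c • a) :
    ∃ M : ℝ, ∀ z ∈ intLattice n, ∀ p q : ℝ, z = p • a + q • b → q ≠ 0 → 1 ≤ M * |q| := by
  obtain ⟨i, j, hij⟩ : ∃ i j, a i * b j - a j * b i ≠ 0 := by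
    by_contra! h
    obtain ⟨i, hi⟩ := Function.ne_iff.1 ha0
    refine hab (b i / a i) (funext fun j => ?_)
    have hi' : a i ≠ 0 := hi
    have := h i j
    rw [Pi.smul_apply, smul_eq_mul]
    field_simp
    linarith
  -- Cramer's rule: `q` times this minor is the corresponding minor of `a` and `z`, a nonzero
  -- integer.
  refine ⟨|a i * b j - a j * b i|, fun z hz p q hzpq hq => ?_⟩
  obtain ⟨ai, hai⟩ := mem_intLattice.1 ha i
  obtain ⟨aj, haj⟩ := mem_intLattice.1 ha j
  obtain ⟨zi, hzi⟩ := mem_intLattice.1 hz i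
  obtain ⟨zj, hzj⟩ := mem_intLattice.1 hz j
  have h1 : (a i * b j - a j * b i) * q = ((ai * zj - aj * zi : ℤ) : ℝ) := by
    push_cast
    rw [← hai, ← haj, ← hzi, ← hzj, hzpq]
    simp only [Pi.add_apply, Pi.smul_apply, smul_eq_mul]
    ring
  have h2 : (ai * zj - aj * zi : ℤ) ≠ 0 := by
    intro h
    rw [h, Int.cast_zero] at h1
    exact mul_ne_zero hij hq h1
  rw [← abs_mul, h1]
  exact_mod_cast Int.one_le_abs h2

lemma exists_uniform_coeff_bound {E : Set (Fin n → ℝ)} (hE : E.Finite) (hEL : E ⊆ intLattice n) :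
    ∃ M : ℝ, 0 < M ∧ ∀ a ∈ E, ∀ b ∈ E, a ≠ 0 → (∀ c : ℝ, b ≠ c • a) →
      ∀ z ∈ intLattice n, ∀ p q : ℝ, z = p • a + q • b → q ≠ 0 → 1 ≤ M * |q| := by
  have h : ∀ᶠ M : ℝ in Filter.atTop, ∀ a ∈ E, ∀ b ∈ E, a ≠ 0 → (∀ c : ℝ, b ≠ c • a) →
      ∀ z ∈ intLattice n, ∀ p q : ℝ, z = p • a + q • b → q ≠ 0 → 1 ≤ M * |q| := by
    rw [Filter.eventually_all_finite hE]
    intro a ha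
    rw [Filter.eventually_all_finite hE]
    intro b hb
    by_cases hab : a ≠ 0 ∧ ∀ c : ℝ, b ≠ c • a
    · obtain ⟨M, hM⟩ := exists_coeff_bound (hEL ha) hab.1 hab.2
      filter_upwards [Filter.eventually_ge_atTop M] with M' hM' _ _ z hz p q hzpq hq
      exact (hM z hz p q hzpq hq).trans (mul_le_mul_of_nonneg_right hM' (abs_nonneg q))
    · exact Filter.Eventually.of_forall fun M h1 h2 => absurd ⟨h1, h2⟩ hab
  obtain ⟨M, hM, hM0⟩ := (h.and (Filter.eventually_gt_atTop 0)).exists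
  exact ⟨M, hM0, hM⟩

/-- The extreme lattice vectors of a cone that span segments with at most `K` lattice points. -/
def shortVecs (K : ℕ) (C : PointedCone ℝ (Fin n → ℝ)) : Set (Fin n → ℝ) :=
  {v | v ∈ intLattice n ∧ IsExtremeVec C v ∧ (segment ℝ 0 v ∩ intLattice n).encard ≤ K}

/-- Such a vector is a positive multiple of some lattice generator `s`, and the multiple is at most
`K`, since otherwise the segment would contain too many multiples of `s`. -/
lemma finite_shortVecs (K : ℕ) {S : Finset (Fin n → ℝ)} (hSL : (S : Set _) ⊆ intLattice n)
    (hS : IsSalient (PointedCone.hull ℝ (S : Set (Fin n → ℝ)))) :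
    (shortVecs K (PointedCone.hull ℝ (S : Set (Fin n → ℝ)))).Finite := by
  refine (finite_intLattice_norm_le (K * ∑ s ∈ S, ‖s‖)).subset ?_
  rintro v ⟨hvL, hv, hK⟩
  refine ⟨hvL, ?_⟩
  obtain ⟨s, hs, a, ha, hsa⟩ := hv.exists_generator hS
  have hva : v = a⁻¹ • s := by rw [hsa, smul_smul, inv_mul_cancel₀ ha.ne', one_smul]
  have h1 := abs_le_of_mem_row (convex_segment 0 v) hK (left_mem_segment ℝ 0 v)
    zero_mem_intLattice (hSL hs) (by rw [hsa]; exact smul_ne_zero ha.ne' hv.2.1) (t := a⁻¹)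
    (by rw [← hva, zero_add]; exact right_mem_segment ℝ 0 v)
  rw [hva, norm_smul, Real.norm_eq_abs]
  exact mul_le_mul h1 (Finset.single_le_sum (f := fun s => ‖s‖) (fun _ _ => norm_nonneg _) hs)
    (norm_nonneg _) (Nat.cast_nonneg K)

lemma IsEdge.mem_shortVecs {P : Set (Fin n → ℝ)} (hP : Convex ℝ P) {K : ℕ}
    (hK : (P ∩ intLattice n).encard ≤ K) (hPL : P.extremePoints ℝ ⊆ intLattice n)
    {u w : Fin n → ℝ} (h : IsEdge P u w) : w - u ∈ shortVecs K (dirCone P u) := by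
  refine ⟨sub_mem_intLattice (hPL h.2.1) (hPL h.1), h.2.2, le_trans ?_ hK⟩
  rw [← (add_right_injective u).encard_image (segment ℝ 0 (w - u) ∩ intLattice n)]
  refine Set.encard_le_encard ?_
  rintro _ ⟨x, ⟨hx, hxL⟩, rfl⟩
  refine ⟨hP.segment_subset h.1.1 h.2.1.1 ?_, add_mem_intLattice (hPL h.1) hxL⟩
  have := (mem_segment_translate ℝ u).2 hx
  simpa using this

lemma image_mem_shortVecs {K : ℕ} {C D : PointedCone ℝ (Fin n → ℝ)}
    (A : (Fin n → ℝ) ≃ₗ[ℝ] (Fin n → ℝ)) (hAL : ∀ x, x ∈ intLattice n ↔ A x ∈ intLattice n)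
    (hA : ∀ x, x ∈ C ↔ A x ∈ D) {v : Fin n → ℝ} (hv : v ∈ shortVecs K C) :
    A v ∈ shortVecs K D := by
  obtain ⟨hvL, ⟨hvC, hv0, hext⟩, hK⟩ := hv
  refine ⟨(hAL v).1 hvL, ⟨(hA v).1 hvC, by simpa using hv0, fun x hx y hy hxy => ?_⟩, ?_⟩
  · obtain ⟨a, ha⟩ := hext (A.symm x) ((hA _).2 (by simpa using hx)) (A.symm y)
      ((hA _).2 (by simpa using hy)) (by rw [← map_add, hxy, A.symm_apply_apply])
    exact ⟨a, by rw [← map_smul, ← ha, A.apply_symm_apply]⟩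
  · have h1 : segment ℝ 0 (A v) ∩ intLattice n = A '' (segment ℝ 0 v ∩ intLattice n) := by
      have h2 : segment ℝ 0 (A v) = A '' segment ℝ 0 v := by
        have := image_segment ℝ A.toLinearMap.toAffineMap 0 v
        simpa using this.symm
      ext x
      rw [h2]
      constructor
      · rintro ⟨⟨y, hy, rfl⟩, hyL⟩
        exact ⟨y, ⟨hy, (hAL y).2 hyL⟩, rfl⟩
      · rintro ⟨y, ⟨hy, hyL⟩, rfl⟩
        exact ⟨⟨y, hy, rfl⟩, (hAL y).1 hyL⟩
    rwa [h1, A.injective.encard_image]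

/-- A linear map is determined by its values on a spanning set. The spanning set may vary with the
map, within the finitely many subsets of `G`. -/
lemma finite_linearMaps {V : Type*} [AddCommGroup V] [Module ℝ V] {G E : Set V} (hG : G.Finite)
    (hE : E.Finite) :
    {A : V →ₗ[ℝ] V | ∃ H ⊆ G, Submodule.span ℝ H = ⊤ ∧ ∀ x ∈ H, A x ∈ E}.Finite := by
  have : {A : V →ₗ[ℝ] V | ∃ H ⊆ G, Submodule.span ℝ H = ⊤ ∧ ∀ x ∈ H, A x ∈ E} ⊆
      ⋃ H ∈ {H | H ⊆ G}, {A : V →ₗ[ℝ] V | Submodule.span ℝ H = ⊤ ∧ ∀ x ∈ H, A x ∈ E} := by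
    rintro A ⟨H, hH, hA⟩
    exact Set.mem_biUnion (x := H) hH hA
  refine (Set.Finite.biUnion hG.finite_subsets fun H hH => ?_).subset this
  have := (hG.subset hH).to_subtype
  refine Set.Finite.of_injOn (f := fun (A : V →ₗ[ℝ] V) (x : H) => A x)
    (t := Set.pi Set.univ fun _ => E) (fun A hA x _ => hA.2 x x.2) ?_ (Set.Finite.pi fun _ => hE)
  intro A hA B _ hAB
  exact LinearMap.ext_on hA.1 fun x hx => congrFun hAB ⟨x, hx⟩

lemma IsLatticePolytope.exists_vertexSet {P : Set (Fin n → ℝ)} (h : IsLatticePolytope P) :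
    ∃ S : Finset (Fin n → ℝ), IsVertexSet P S ∧ (S : Set _) ⊆ intLattice n := by
  obtain ⟨S, hS, hSL, rfl⟩ := h
  have hsub := extremePoints_convexHull_subset (𝕜 := ℝ) (A := S)
  have hfin := hS.subset hsub
  refine ⟨hfin.toFinset, ⟨?_, fun x => by simp⟩, by simpa using hsub.trans hSL⟩
  have h1 := closure_convexHull_extremePoints (hS.isCompact_convexHull ℝ) (convex_convexHull ℝ S)
  rw [(hfin.isCompact_convexHull ℝ).isClosed.closure_eq] at h1
  simpa using h1.symm

end Lattice

/-! ### Finiteness of framed polytopes -/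

section Framed

variable {d : ℕ}

/-- Full-dimensional lattice polytopes with at most `K` lattice points and a vertex at the
origin, with tangent cones from a given list: at the origin on the nose, at the other vertices
up to unimodular transformations. -/
structure IsFramed (K : ℕ) (T : Set (PointedCone ℝ (Fin d → ℝ))) (P : Set (Fin d → ℝ)) : Prop where
  isLatticePolytope : IsLatticePolytope P
  encard_le : (P ∩ intLattice d).encard ≤ K
  zero_mem : 0 ∈ P.extremePoints ℝ
  dirCone_zero : dirCone P 0 ∈ T
  span_dirCone : ∀ u ∈ P.extremePoints ℝ,
    Submodule.span ℝ (dirCone P u : Set (Fin d → ℝ)) = ⊤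
  dirCone_mem : ∀ u ∈ P.extremePoints ℝ, ∃ A : (Fin d → ℝ) ≃ₗ[ℝ] (Fin d → ℝ),
    (∀ x, x ∈ intLattice d ↔ A x ∈ intLattice d) ∧ ∃ τ ∈ T, ∀ x, x ∈ dirCone P u ↔ A x ∈ τ

lemma IsFramed.finite_shortVecs {K : ℕ} {T : Set (PointedCone ℝ (Fin d → ℝ))}
    {P : Set (Fin d → ℝ)} (h : IsFramed K T P) {u : Fin d → ℝ} (hu : u ∈ P.extremePoints ℝ) :
    (shortVecs K (dirCone P u)).Finite := by
  classical
  obtain ⟨S, hS, hSL⟩ := h.isLatticePolytope.exists_vertexSet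
  have hs := isSalient_dirCone hS.convex hu
  rw [hS.dirCone_eq u] at hs ⊢
  refine LatticePolytopes.finite_shortVecs K ?_ hs
  intro x hx
  obtain ⟨w, hw, rfl⟩ := Finset.mem_image.1 (Finset.mem_coe.1 hx)
  exact sub_mem_intLattice (hSL hw) (hSL ((hS.mem_iff u).2 hu))

/-- In a polytope with few lattice points, parallel edges at the end points of an edge differ by
a bounded amount. -/
lemma norm_parallel_edge_le {P : Set (Fin d → ℝ)} (hP : Convex ℝ P) {K : ℕ}
    (hK : (P ∩ intLattice d).encard ≤ K) (hPL : P.extremePoints ℝ ⊆ intLattice d)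
    {u u' w w' : Fin d → ℝ} (hu : u ∈ P.extremePoints ℝ) (hu' : u' ∈ P.extremePoints ℝ)
    (hw : w ∈ P.extremePoints ℝ) (hw' : w' ∈ P.extremePoints ℝ) (huu : u' - u ≠ 0)
    {a b M : ℝ} (ha : 0 < a) (haM : a ≤ M) (hab : w' - u' = a • (w - u) + b • (u' - u)) :
    ‖w' - u'‖ ≤ M * ‖w - u‖ + (K * (M + 1) + 1) * ‖u' - u‖ := by
  have hvL := sub_mem_intLattice (hPL hu') (hPL hu)
  have hM : 0 < M := ha.trans_le haM
  have hK0 : (0 : ℝ) ≤ K := Nat.cast_nonneg K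
  -- Since `w' - u = a • (w - u) + (1 + b) • (u' - u)`, contracting the longer side towards `u` by
  -- `1 / a` or `a` gives a point of `P` on the row through `w` (if `a ≥ 1`) or through `w'` (if `a
  -- < 1`), where the row bound applies.
  have hb : |1 + b| ≤ K * (M + 1) := by
    rcases le_or_gt 1 a with h1 | h1
    · have hmem : w + ((1 + b) / a) • (u' - u) ∈ P := by
        have h2 := hP.add_smul_sub_mem hu.1 hw'.1 (t := a⁻¹)
          ⟨inv_nonneg.2 ha.le, inv_le_one_of_one_le₀ h1⟩
        have h3 : w' - u = a • (w - u) + (1 + b) • (u' - u) := by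
          have : w' - u = (w' - u') + (u' - u) := by abel
          rw [this, hab]; module
        rw [h3, smul_add, smul_smul, smul_smul, inv_mul_cancel₀ ha.ne', one_smul,
          ← div_eq_inv_mul] at h2
        convert h2 using 1
        abel
      have h4 := abs_le_of_mem_row hP hK hw.1 (hPL hw) hvL huu hmem
      rw [abs_div, abs_of_pos ha, div_le_iff₀ ha] at h4
      exact h4.trans (mul_le_mul_of_nonneg_left (by linarith) hK0)
    · have hmem : w' + (-(1 + b)) • (u' - u) ∈ P := by
        have h2 := hP.add_smul_sub_mem hu.1 hw.1 (t := a) ⟨ha.le, h1.le⟩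
        have h3 : w' + (-(1 + b)) • (u' - u) = u + a • (w - u) := by
          have : w' = (w' - u') + u' := by abel
          rw [this, hab]; module
        rwa [h3]
      have h4 := abs_le_of_mem_row hP hK hw'.1 (hPL hw') hvL huu hmem
      rw [abs_neg] at h4
      exact h4.trans (le_mul_of_one_le_right hK0 (by linarith))
  have hb' : |b| ≤ K * (M + 1) + 1 := by
    have : b = (1 + b) - 1 := by ring
    rw [this]
    refine (abs_sub _ _).trans ?_
    rw [abs_one]
    linarith
  rw [hab]
  refine (norm_add_le _ _).trans ?_
  rw [norm_smul, norm_smul, Real.norm_eq_abs, Real.norm_eq_abs, abs_of_pos ha]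
  gcongr

/-- The heart of the argument: along a given edge from a known cone, the cone at the far end is the
preimage of `τ` under `A`, and only finitely many `A` can occur. -/
lemma finite_next_of_edge (K : ℕ) (T : Set (PointedCone ℝ (Fin d → ℝ))) (u v : Fin d → ℝ)
    (C τ : PointedCone ℝ (Fin d → ℝ)) :
    {X : (Fin d → ℝ) × PointedCone ℝ (Fin d → ℝ) | ∃ P, IsFramed K T P ∧ dirCone P u = C ∧
      IsEdge P u (u + v) ∧ X = (u + v, dirCone P (u + v)) ∧
      ∃ A : (Fin d → ℝ) ≃ₗ[ℝ] (Fin d → ℝ), (∀ x, x ∈ intLattice d ↔ A x ∈ intLattice d) ∧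
        ∀ x, x ∈ dirCone P (u + v) ↔ A x ∈ τ}.Finite := by
  -- Assuming the set infinite only provides a witness `P₀`, which shows that `C` and `τ` have
  -- finitely many short vectors.
  refine Set.not_infinite.1 fun hinf => ?_
  obtain ⟨-, P₀, hP₀, hC₀, he₀, -, A₀, hA₀L, hA₀⟩ := hinf.nonempty
  refine hinf ?_
  have hEC : (shortVecs K C).Finite := hC₀ ▸ hP₀.finite_shortVecs he₀.1
  have hEτ : (shortVecs K τ).Finite := by
    refine ((hP₀.finite_shortVecs he₀.2.1).image A₀).subset fun x hx => ?_
    refine ⟨A₀.symm x, image_mem_shortVecs A₀.symm (fun y => ?_) (fun y => ?_) hx,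
      A₀.apply_symm_apply x⟩
    · rw [hA₀L (A₀.symm y), A₀.apply_symm_apply]
    · rw [hA₀ (A₀.symm y), A₀.apply_symm_apply]
  obtain ⟨M, hM0, hM⟩ := exists_uniform_coeff_bound hEτ fun x hx => hx.1
  obtain ⟨r, hr⟩ : ∃ r : ℝ, ∀ g ∈ shortVecs K C, ‖g‖ ≤ r := by
    obtain ⟨r, hr⟩ := (hEC.image norm).bddAbove
    exact ⟨r, fun g hg => hr (Set.mem_image_of_mem _ hg)⟩
  set G : Set (Fin d → ℝ) :=
    insert (-v) {x ∈ intLattice d | ‖x‖ ≤ M * r + (K * (M + 1) + 1) * ‖v‖}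
  have hGfin : G.Finite := (finite_intLattice_norm_le _).insert _
  refine ((finite_linearMaps hGfin hEτ).image
    fun A => (u + v, PointedCone.comap A τ)).subset ?_
  rintro X ⟨P, hP, hC, he, rfl, A, hAL, hA⟩
  obtain ⟨S, hS, hSL⟩ := hP.isLatticePolytope.exists_vertexSet
  have hPL : P.extremePoints ℝ ⊆ intLattice d := fun x hx => hSL ((hS.mem_iff x).2 hx)
  have hshort : ∀ {x y}, IsEdge P x y → y - x ∈ shortVecs K (dirCone P x) := fun h =>
    h.mem_shortVecs hS.convex hP.encard_le hPL
  have hsymm := he.symm hS.convex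
  have hvneg : u - (u + v) = -v := by abel
  have hvpos : u + v - u = v := by abel
  have hv0 : v ≠ 0 := hvpos ▸ he.2.2.2.1
  have hspan := hS.dirCone_le_span_parallel he
  rw [hvneg, hvpos] at hspan
  generalize hH : {x | ∃ w', _} = H at hspan
  have hAv : A (-v) ∈ shortVecs K τ := by
    have h1 := hshort hsymm
    rw [hvneg] at h1
    exact image_mem_shortVecs A hAL hA h1
  refine ⟨A.toLinearMap, ⟨insert (-v) H, ?_, top_le_iff.1 ?_, ?_⟩, ?_⟩
  rotate_left 1
  · rw [← hP.span_dirCone u he.1]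
    exact Submodule.span_le.2 hspan
  · subst hH
    rintro x (rfl | ⟨w', hw', rfl, -⟩)
    · exact hAv
    · exact image_mem_shortVecs A hAL hA (hshort hw')
  · refine Prod.ext rfl (PointedCone.ext fun x => (hA x).symm)
  · subst hH
    refine Set.insert_subset_insert ?_
    rintro x ⟨w', hw', rfl, w, hw, hne, a, b, ha, hab⟩
    have hwC : w - u ∈ shortVecs K C := hC ▸ hshort hw
    have hw'L := hshort hw'
    refine ⟨hw'L.1, ?_⟩
    -- The relation is solved for the edge at `u` and moved to `τ`, because the bound `M` is uniform
    -- only over the fixed finite set of short vectors of `τ`. The coefficient `a⁻¹` of this lattice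
    -- vector is then at least `M⁻¹`.
    have hAg : A (w - u) = (b / a) • A (-v) + a⁻¹ • A (w' - (u + v)) := by
      rw [hab, map_add, map_smul, map_smul, map_neg, smul_add, smul_smul, smul_smul,
        inv_mul_cancel₀ ha.ne', div_eq_inv_mul]
      module
    have haM : a ≤ M := by
      have h1 := hM (A (-v)) hAv (A (w' - (u + v))) (image_mem_shortVecs A hAL hA hw'L)
        (by simpa using hv0) ?_ (A (w - u)) ((hAL _).1 hwC.1) _ _ hAg (inv_ne_zero ha.ne')
      · rwa [abs_of_pos (inv_pos.2 ha), ← div_eq_mul_inv, one_le_div ha] at h1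
      · intro c hc
        rw [← map_smul] at hc
        have h2 := A.injective hc
        apply hne (a⁻¹ * (-c - b))
        have h3 : a • (w - u) = (-c - b) • v := by
          rw [hab] at h2
          have : a • (w - u) = (a • (w - u) + b • v) - b • v := by abel
          rw [this, h2]
          module
        rw [mul_smul, ← h3, smul_smul, inv_mul_cancel₀ ha.ne', one_smul]
    have h4 := norm_parallel_edge_le hS.convex hP.encard_le hPL he.1 he.2.1 hw.2.1 hw'.2.1
      (by rwa [hvpos]) ha haM (by rwa [hvpos])
    rw [hvpos] at h4
    refine h4.trans ?_
    gcongr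
    exact hr _ hwC

lemma finite_next (K : ℕ) {T : Set (PointedCone ℝ (Fin d → ℝ))} (hT : T.Finite) (u : Fin d → ℝ)
    (C : PointedCone ℝ (Fin d → ℝ)) :
    {X : (Fin d → ℝ) × PointedCone ℝ (Fin d → ℝ) | ∃ P, IsFramed K T P ∧ dirCone P u = C ∧
      ∃ w, IsEdge P u w ∧ X = (w, dirCone P w)}.Finite := by
  by_cases hex : ∃ P, IsFramed K T P ∧ u ∈ P.extremePoints ℝ ∧ dirCone P u = C
  · obtain ⟨P₀, hP₀, hu₀, hC₀⟩ := hex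
    have hEC : (shortVecs K C).Finite := hC₀ ▸ hP₀.finite_shortVecs hu₀
    refine (hEC.biUnion fun v _ => hT.biUnion fun τ _ =>
      finite_next_of_edge K T u v C τ).subset ?_
    rintro X ⟨P, hP, hC, w, hw, rfl⟩
    obtain ⟨S, hS, hSL⟩ := hP.isLatticePolytope.exists_vertexSet
    have hv := hw.mem_shortVecs hS.convex hP.encard_le fun x hx => hSL ((hS.mem_iff x).2 hx)
    obtain ⟨A, hAL, τ, hτ, hA⟩ := hP.dirCone_mem w hw.2.1
    have huw : u + (w - u) = w := by abel
    refine Set.mem_biUnion (hC ▸ hv) (Set.mem_biUnion hτ ⟨P, hP, hC, ?_⟩)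
    rw [huw]
    exact ⟨hw, rfl, A, hAL, hA⟩
  · refine Set.finite_empty.subset ?_
    rintro X ⟨P, hP, hC, w, hw, -⟩
    exact hex ⟨P, hP, hw.1, hC⟩

lemma finite_reach (K : ℕ) {T : Set (PointedCone ℝ (Fin d → ℝ))} (hT : T.Finite) (k : ℕ) :
    {X : (Fin d → ℝ) × PointedCone ℝ (Fin d → ℝ) | ∃ P, IsFramed K T P ∧
      ∃ w ∈ reach P 0 k, X = (w, dirCone P w)}.Finite := by
  induction k with
  | zero =>
    refine (hT.image fun C => ((0 : Fin d → ℝ), C)).subset ?_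
    rintro X ⟨P, hP, w, hw, rfl⟩
    have : w = 0 := hw
    subst this
    exact ⟨dirCone P 0, hP.dirCone_zero, rfl⟩
  | succ k ih =>
    refine (ih.union (ih.biUnion fun X _ => finite_next K hT X.1 X.2)).subset ?_
    rintro X ⟨P, hP, w, hw | ⟨x, hx, hw⟩, rfl⟩
    · exact Or.inl ⟨P, hP, w, hw, rfl⟩
    · refine Or.inr (Set.mem_biUnion (x := (x, dirCone P x)) ⟨P, hP, x, hx, rfl⟩ ?_)
      exact ⟨P, hP, rfl, w, hw, rfl⟩

/-- The finiteness theorem in coordinates. -/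
theorem finite_isFramed (K : ℕ) {T : Set (PointedCone ℝ (Fin d → ℝ))} (hT : T.Finite) :
    {P | IsFramed K T P}.Finite := by
  refine ((((finite_reach K hT K).image Prod.fst).finite_subsets).image
    fun R => convexHull ℝ R).subset ?_
  intro P hP
  obtain ⟨S, hS, hSL⟩ := hP.isLatticePolytope.exists_vertexSet
  have hcard : S.card ≤ K := by
    have h1 : (S : Set (Fin d → ℝ)).encard ≤ K :=
      (Set.encard_le_encard (t := P ∩ intLattice d)
        fun x hx => ⟨hS.mem hx, hSL hx⟩).trans hP.encard_le
    rw [Set.encard_coe_eq_coe_finsetCard] at h1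
    exact_mod_cast h1
  refine ⟨S, ?_, hS.eq_hull.symm⟩
  intro w hw
  refine ⟨((w, dirCone P w) : (Fin d → ℝ) × PointedCone ℝ (Fin d → ℝ)), ⟨P, hP, w, ?_, rfl⟩, rfl⟩
  rw [hS.reach_eq hP.zero_mem hcard]
  exact (hS.mem_iff w).1 hw

end Framed

/-! ### Lattice coordinates and duality with normal cones -/

section Coordinates

/-- A rational subspace has a basis that generates its lattice points. -/
lemma exists_lattice_basis {n d : ℕ} (W : Submodule ℝ (Fin n → ℝ))
    (hW : W ≤ Submodule.span ℝ ((W : Set (Fin n → ℝ)) ∩ intLattice n))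
    (hd : Module.finrank ℝ W = d) :
    ∃ b : Module.Basis (Fin d) ℝ W,
      ∀ x : W, (x : Fin n → ℝ) ∈ intLattice n ↔ b.equivFun x ∈ intLattice d := by
  set Λ : Submodule ℤ (Fin n → ℝ) := Submodule.span ℤ (Set.range (Pi.basisFun ℝ (Fin n))) with hΛ
  have hmem : ∀ x, x ∈ Λ ↔ x ∈ intLattice n := fun x => by
    rw [hΛ, (Pi.basisFun ℝ (Fin n)).mem_span_iff_repr_mem ℤ x, mem_intLattice]
    simp [eq_comm]
  set L : Submodule ℤ W := ZLattice.comap ℝ Λ W.subtype with hL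
  have hLmem : ∀ x : W, x ∈ L ↔ (x : Fin n → ℝ) ∈ intLattice n := fun x => hmem x
  have : DiscreteTopology L :=
    ZLattice.comap_discreteTopology ℝ Λ continuous_subtype_val W.injective_subtype
  have : IsZLattice ℝ L := by
    refine ⟨Submodule.map_injective_of_injective W.injective_subtype ?_⟩
    rw [Submodule.map_span, Submodule.map_top, Submodule.range_subtype]
    refine le_antisymm (Submodule.span_le.2 ?_) (hW.trans (Submodule.span_mono ?_))
    · rintro _ ⟨x, -, rfl⟩
      exact x.2
    · rintro x ⟨hx, hxL⟩
      exact ⟨⟨x, hx⟩, (hLmem _).2 hxL, rfl⟩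
  have hcard : Fintype.card (Module.Free.ChooseBasisIndex ℤ L) = Fintype.card (Fin d) := by
    rw [← Module.finrank_eq_card_chooseBasisIndex, ZLattice.rank ℝ L, hd, Fintype.card_fin]
  let b := (Module.Free.chooseBasis ℤ L).reindex (Fintype.equivOfCardEq hcard)
  refine ⟨b.ofZLatticeBasis ℝ L, fun x => ?_⟩
  rw [← hLmem, mem_intLattice]
  conv_lhs => rw [← b.ofZLatticeBasis_span ℝ L]
  rw [Module.Basis.mem_span_iff_repr_mem]
  simp [eq_comm]

lemma IsRationalCone.span_le {m : ℕ} {σ : PointedCone ℝ (Fin m → ℝ)} (h : IsRationalCone σ) :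
    Submodule.span ℝ (σ : Set (Fin m → ℝ)) ≤
      Submodule.span ℝ ((Submodule.span ℝ (σ : Set (Fin m → ℝ)) : Set (Fin m → ℝ)) ∩
        intLattice m) := by
  obtain ⟨S, -, hSL, rfl⟩ := h
  refine Submodule.span_le.2 fun x hx => ?_
  have hxS : x ∈ Submodule.span ℝ S := PointedCone.hull_le_span ℝ S hx
  refine Submodule.span_mono (fun s hs => Set.mem_inter ?_ (hSL hs)) hxS
  exact Submodule.subset_span (PointedCone.subset_hull hs)

lemma dirSpace_le_span {n : ℕ} {P : Set (Fin n → ℝ)} (h : IsLatticePolytope P) :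
    dirSpace P ≤ Submodule.span ℝ ((dirSpace P : Set (Fin n → ℝ)) ∩ intLattice n) := by
  obtain ⟨S, -, hSL, rfl⟩ := h
  have hdir : dirSpace (convexHull ℝ S) = Submodule.span ℝ (S -ᵥ S) := by
    rw [dirSpace, affineSpan_convexHull, direction_affineSpan, vectorSpan_def]
  rw [hdir]
  refine Submodule.span_mono fun x hx => ⟨Submodule.subset_span hx, ?_⟩
  obtain ⟨a, ha, b, hb, rfl⟩ := hx
  exact sub_mem_intLattice (hSL ha) (hSL hb)

lemma mem_tangentCone {n : ℕ} {P : Set (Fin n → ℝ)} (hP : Convex ℝ P) {u : Fin n → ℝ}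
    (hu : u ∈ P) {x : dirSpace P} :
    x ∈ tangentCone P u ↔ (x : Fin n → ℝ) ∈ dirCone P u := by
  constructor
  · intro h
    have : tangentCone P u ≤ (dirCone P u).comap (dirSpace P).subtype :=
      Submodule.span_le.2 fun y hy => PointedCone.subset_hull hy
    exact this h
  · intro h
    obtain ⟨t, ht, p, hp, hx⟩ := (mem_dirCone hP hu).1 h
    have hpu : p - u ∈ dirSpace P :=
      AffineSubspace.vsub_mem_direction (subset_affineSpan ℝ P hp) (subset_affineSpan ℝ P hu)
    have : x = t • (⟨p - u, hpu⟩ : dirSpace P) := Subtype.ext hx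
    rw [this]
    exact smul_mem_cone (PointedCone.subset_hull (by simpa using hp)) ht

/-- A tangent cone at a vertex is the dual of the normal cone. -/
lemma mem_tangentCone_iff_normalCone {n : ℕ} {P : Set (Fin n → ℝ)} {S : Finset (Fin n → ℝ)}
    (hS : IsVertexSet P S) {u : Fin n → ℝ} (hu : u ∈ P.extremePoints ℝ) {x : dirSpace P} :
    x ∈ tangentCone P u ↔ ∀ ψ ∈ normalCone P u, 0 ≤ ψ x := by
  classical
  refine ⟨fun hx ψ hψ => hψ hx, fun h => ?_⟩
  rw [mem_tangentCone hS.convex hu.1]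
  by_contra hx
  have hs := isSalient_dirCone hS.convex hu
  rw [hS.dirCone_eq] at hx hs
  obtain ⟨c, hc, hcx⟩ := exists_dual_neg hs hx
  refine absurd (h (c.toLinearMap.comp (dirSpace P).subtype) fun y hy => ?_) (not_le.2 hcx)
  have hy' := (mem_tangentCone hS.convex hu.1).1 hy
  rw [hS.dirCone_eq] at hy'
  obtain ⟨a, ha, hay⟩ := mem_hull_finset.1 hy'
  change 0 ≤ c y
  rw [← hay, map_sum]
  refine Finset.sum_nonneg fun s hs => ?_
  rw [map_smul, smul_eq_mul]
  exact mul_nonneg (ha s hs) (hc s hs)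

/-- A vector killed by all normals lies with its negative in the salient tangent cone. Consequently
an equivalence of normal cones, given only on spans, is defined on the whole dual space. -/
lemma span_normalCone {n : ℕ} {P : Set (Fin n → ℝ)} {S : Finset (Fin n → ℝ)}
    (hS : IsVertexSet P S) {u : Fin n → ℝ} (hu : u ∈ P.extremePoints ℝ) :
    Submodule.span ℝ (normalCone P u : Set (Module.Dual ℝ (dirSpace P))) = ⊤ := by
  rw [← Subspace.dualCoannihilator_dualAnnihilator_eq
    (W := Submodule.span ℝ (normalCone P u : Set (Module.Dual ℝ (dirSpace P)))),
    Submodule.dualAnnihilator_eq_top_iff, eq_bot_iff]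
  intro x hx
  have h0 : ∀ ψ ∈ normalCone P u, ψ x = 0 := fun ψ hψ =>
    (Submodule.mem_dualCoannihilator x).1 hx ψ (Submodule.subset_span hψ)
  have h1 : x ∈ tangentCone P u :=
    (mem_tangentCone_iff_normalCone hS hu).2 fun ψ hψ => (h0 ψ hψ).ge
  have h2 : -x ∈ tangentCone P u :=
    (mem_tangentCone_iff_normalCone hS hu).2 fun ψ hψ => by rw [map_neg, h0 ψ hψ, neg_zero]
  rw [mem_tangentCone hS.convex hu.1] at h1 h2
  exact Subtype.ext (isSalient_dirCone hS.convex hu _ h1 h2)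

/-- The dual of a cone, in coordinates with respect to a basis of the span of the cone. -/
def coordDual {m d : ℕ} (σ : PointedCone ℝ (Fin m → ℝ))
    (b : Module.Basis (Fin d) ℝ (Submodule.span ℝ (σ : Set (Fin m → ℝ)))) :
    PointedCone ℝ (Fin d → ℝ) :=
  PointedCone.dual (dotProductBilin ℝ ℝ)
    (b.equivFun '' {w | (w : Fin m → ℝ) ∈ σ})

lemma mem_coordDual {m d : ℕ} {σ : PointedCone ℝ (Fin m → ℝ)}
    {b : Module.Basis (Fin d) ℝ (Submodule.span ℝ (σ : Set (Fin m → ℝ)))} {y : Fin d → ℝ} :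
    y ∈ coordDual σ b ↔ ∀ w : Submodule.span ℝ (σ : Set (Fin m → ℝ)), (w : Fin m → ℝ) ∈ σ →
      0 ≤ ∑ i, b.equivFun w i * y i := by
  simp only [coordDual, PointedCone.mem_dual, Set.forall_mem_image]
  rfl

/-- Coordinates on the space of `P`, adapted to the normal cone at a vertex. -/
lemma exists_coordinates {n m d : ℕ} {P : Set (Fin n → ℝ)} (hP : IsLatticePolytope P)
    {u : Fin n → ℝ} (hu : u ∈ P.extremePoints ℝ) {σ : PointedCone ℝ (Fin m → ℝ)}
    (b : Module.Basis (Fin d) ℝ (Submodule.span ℝ (σ : Set (Fin m → ℝ))))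
    (hb : ∀ w : Submodule.span ℝ (σ : Set (Fin m → ℝ)),
      (w : Fin m → ℝ) ∈ intLattice m ↔ b.equivFun w ∈ intLattice d)
    (h : ConesEquivalent (dualLattice P) (normalCone P u) (intLattice m) σ) :
    ∃ φ : dirSpace P ≃ₗ[ℝ] (Fin d → ℝ),
      (∀ x : dirSpace P, (x : Fin n → ℝ) ∈ intLattice n ↔ φ x ∈ intLattice d) ∧
      ∀ x, x ∈ tangentCone P u ↔ φ x ∈ coordDual σ b := by
  obtain ⟨S, hS, hSL⟩ := hP.exists_vertexSet
  obtain ⟨f, hfL, hfC⟩ := h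
  have htop := span_normalCone hS hu
  let e : Module.Dual ℝ (dirSpace P) ≃ₗ[ℝ] Submodule.span ℝ (σ : Set (Fin m → ℝ)) :=
    (LinearEquiv.ofTop _ htop).symm.trans f
  have heL : ∀ ψ, ψ ∈ dualLattice P ↔ (e ψ : Fin m → ℝ) ∈ intLattice m := fun ψ =>
    hfL ((LinearEquiv.ofTop _ htop).symm ψ)
  have heC : ∀ ψ, ψ ∈ normalCone P u ↔ (e ψ : Fin m → ℝ) ∈ σ := fun ψ =>
    hfC ((LinearEquiv.ofTop _ htop).symm ψ)
  -- The transpose of `e` in the basis `b`: evaluation of functionals becomes the dot product.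
  let φ₀ : dirSpace P →ₗ[ℝ] (Fin d → ℝ) := LinearMap.pi fun i => e.symm (b i)
  have hφ₀ : ∀ ψ x, ψ x = ∑ i, b.equivFun (e ψ) i * φ₀ x i := by
    intro ψ x
    conv_lhs => rw [← e.symm_apply_apply ψ, ← b.sum_equivFun (e ψ), map_sum, LinearMap.sum_apply]
    refine Finset.sum_congr rfl fun i _ => ?_
    rw [map_smul]
    rfl
  have hinj : Function.Injective φ₀ := by
    rw [← LinearMap.ker_eq_bot, LinearMap.ker_eq_bot']
    intro x hx
    rw [← Module.forall_dual_apply_eq_zero_iff ℝ]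
    intro ψ
    rw [hφ₀, hx]
    simp
  have hdim : Module.finrank ℝ (dirSpace P) = Module.finrank ℝ (Fin d → ℝ) := by
    rw [← Subspace.dual_finrank_eq, e.finrank_eq, b.equivFun.finrank_eq]
  refine ⟨φ₀.linearEquivOfInjective hinj hdim, fun x => ?_, fun x => ?_⟩
  · rw [LinearMap.linearEquivOfInjective_apply]
    constructor
    · intro hx
      refine mem_intLattice.2 fun i => ?_
      have h1 : e.symm (b i) ∈ dualLattice P := by
        rw [heL, e.apply_symm_apply, hb, mem_intLattice]
        intro j
        refine ⟨if i = j then 1 else 0, ?_⟩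
        rw [b.equivFun_apply, b.repr_self_apply]
        push_cast
        rfl
      exact h1 x hx
    · intro hx
      -- The lattice is recovered from its dual: the coordinate functionals of a lattice basis lie
      -- in the dual lattice, and their values at `x` are dot products of integer vectors.
      obtain ⟨a, ha⟩ := exists_lattice_basis (dirSpace P) (dirSpace_le_span hP) rfl
      rw [ha, mem_intLattice]
      intro j
      have h1 : a.coord j ∈ dualLattice P := fun y hy => by
        have := mem_intLattice.1 ((ha y).1 hy) j
        simpa using this
      have h2 := mem_intLattice.1 ((hb _).1 ((heL _).1 h1))
      choose k hk using h2
      choose l hl using mem_intLattice.1 hx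
      refine ⟨∑ i, k i * l i, ?_⟩
      have h3 := hφ₀ (a.coord j) x
      simp only [hk, hl] at h3
      rw [a.equivFun_apply, ← a.coord_apply, h3]
      push_cast
      rfl
  · rw [LinearMap.linearEquivOfInjective_apply, mem_tangentCone_iff_normalCone hS hu,
      mem_coordDual]
    constructor
    · intro h w hw
      have h1 := h (e.symm w) ((heC _).2 (by rwa [e.apply_symm_apply]))
      rwa [hφ₀, e.apply_symm_apply] at h1
    · intro h ψ hψ
      rw [hφ₀]
      exact h (e ψ) ((heC ψ).1 hψ)

end Coordinates

lemma mem_extremePoints_preimage {V W : Type*} [AddCommGroup V] [Module ℝ V] [AddCommGroup W]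
    [Module ℝ W] {f : V →ᵃ[ℝ] W} (hf : Function.Injective f) {P : Set W} (hP : P ⊆ Set.range f)
    {y : V} : y ∈ (f ⁻¹' P).extremePoints ℝ ↔ f y ∈ P.extremePoints ℝ := by
  have hseg : ∀ a b y, f y ∈ openSegment ℝ (f a) (f b) ↔ y ∈ openSegment ℝ a b := fun a b y => by
    rw [← image_openSegment, hf.mem_set_image]
  rw [mem_extremePoints, mem_extremePoints]
  refine and_congr Iff.rfl ⟨fun h p hp q hq hy => ?_, fun h a ha b hb hy => ?_⟩
  · obtain ⟨a, rfl⟩ := hP hp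
    obtain ⟨b, rfl⟩ := hP hq
    obtain ⟨rfl, rfl⟩ := h a hp b hq ((hseg a b y).1 hy)
    exact ⟨rfl, rfl⟩
  · obtain ⟨h1, h2⟩ := h _ ha _ hb ((hseg a b y).2 hy)
    exact ⟨hf h1, hf h2⟩

/-! ### Charts of polytopes and integral equivalence -/

section Chart

variable {n d : ℕ}

/-- The affine parametrization of the affine span of `P` by coordinates centred at `u`. -/
def chart {P : Set (Fin n → ℝ)} (u : Fin n → ℝ) (φ : dirSpace P ≃ₗ[ℝ] (Fin d → ℝ)) :
    (Fin d → ℝ) →ᵃ[ℝ] (Fin n → ℝ) :=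
  AffineMap.const ℝ _ u + ((dirSpace P).subtype.comp φ.symm.toLinearMap).toAffineMap

variable {P : Set (Fin n → ℝ)} {u : Fin n → ℝ} {φ : dirSpace P ≃ₗ[ℝ] (Fin d → ℝ)}

lemma chart_apply (y : Fin d → ℝ) : chart u φ y = u + (φ.symm y : Fin n → ℝ) := rfl

lemma chart_injective : Function.Injective (chart u φ) := fun _ _ h =>
  φ.symm.injective (Subtype.ext (add_left_cancel h))

lemma chart_sub (x y : Fin d → ℝ) : chart u φ x - chart u φ y = (φ.symm (x - y) : Fin n → ℝ) := by
  rw [chart_apply, chart_apply, map_sub, Submodule.coe_sub]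
  abel

lemma exists_chart_eq {p : Fin n → ℝ} (hu : u ∈ P) (hp : p ∈ affineSpan ℝ P) :
    ∃ x : dirSpace P, p - u = x ∧ chart u φ (φ x) = p := by
  refine ⟨⟨p - u, AffineSubspace.vsub_mem_direction hp (subset_affineSpan ℝ P hu)⟩, rfl, ?_⟩
  rw [chart_apply, φ.symm_apply_apply]
  simp

lemma subset_range_chart (hu : u ∈ P) : P ⊆ Set.range (chart u φ) := fun _ hp =>
  let ⟨x, _, hx⟩ := exists_chart_eq hu (subset_affineSpan ℝ P hp)
  ⟨φ x, hx⟩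

lemma image_chart_preimage (hu : u ∈ P) : chart u φ '' (chart u φ ⁻¹' P) = P :=
  Set.image_preimage_eq_of_subset (subset_range_chart hu)

lemma chart_mem_intLattice (huL : u ∈ intLattice n)
    (hφ : ∀ x : dirSpace P, (x : Fin n → ℝ) ∈ intLattice n ↔ φ x ∈ intLattice d) {y : Fin d → ℝ} :
    chart u φ y ∈ intLattice n ↔ y ∈ intLattice d := by
  have h1 := hφ (φ.symm y)
  rw [φ.apply_symm_apply] at h1
  rw [← h1, chart_apply]
  refine ⟨fun h => ?_, fun h => add_mem_intLattice huL h⟩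
  have := sub_mem_intLattice h huL
  rwa [add_sub_cancel_left] at this

lemma isLatticePolytope_chart (hu : u ∈ P) (huL : u ∈ intLattice n)
    (hφ : ∀ x : dirSpace P, (x : Fin n → ℝ) ∈ intLattice n ↔ φ x ∈ intLattice d)
    (hP : IsLatticePolytope P) : IsLatticePolytope (chart u φ ⁻¹' P) := by
  obtain ⟨S, hSfin, hSL, hPS⟩ := hP
  refine ⟨chart u φ ⁻¹' S, hSfin.preimage chart_injective.injOn,
    fun y hy => (chart_mem_intLattice huL hφ).1 (hSL hy), ?_⟩
  apply (Set.image_injective.2 (chart_injective (u := u) (φ := φ)))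
  have hSP : S ⊆ P := by rw [hPS]; exact subset_convexHull ℝ S
  rw [image_chart_preimage hu, AffineMap.image_convexHull,
    Set.image_preimage_eq_of_subset (hSP.trans (subset_range_chart hu)), ← hPS]

lemma encard_chart (hu : u ∈ P) (huL : u ∈ intLattice n)
    (hφ : ∀ x : dirSpace P, (x : Fin n → ℝ) ∈ intLattice n ↔ φ x ∈ intLattice d) :
    (chart u φ ⁻¹' P ∩ intLattice d).encard = (P ∩ intLattice n).encard := by
  have : chart u φ ⁻¹' P ∩ intLattice d = chart u φ ⁻¹' (P ∩ intLattice n) := by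
    ext y
    exact and_congr Iff.rfl (chart_mem_intLattice huL hφ).symm
  rw [this, ← chart_injective.encard_image, Set.image_preimage_eq_of_subset
    (Set.inter_subset_left.trans (subset_range_chart hu))]

lemma mem_dirCone_chart (hu : u ∈ P) (hP : Convex ℝ P) {y x : Fin d → ℝ}
    (hy : chart u φ y ∈ P) :
    x ∈ dirCone (chart u φ ⁻¹' P) y ↔ (φ.symm x : Fin n → ℝ) ∈ dirCone P (chart u φ y) := by
  rw [mem_dirCone (hP.affine_preimage _) hy, mem_dirCone hP hy]
  constructor
  · rintro ⟨t, ht, p, hp, rfl⟩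
    exact ⟨t, ht, chart u φ p, hp, by rw [chart_sub, map_smul]; rfl⟩
  · rintro ⟨t, ht, p, hp, h⟩
    obtain ⟨p, rfl⟩ := subset_range_chart (φ := φ) hu hp
    refine ⟨t, ht, p, hp, φ.symm.injective (Subtype.ext ?_)⟩
    rw [h, chart_sub, map_smul]
    rfl

lemma span_dirCone_chart (hu : u ∈ P) {y : Fin d → ℝ} (hy : chart u φ y ∈ P) :
    Submodule.span ℝ (dirCone (chart u φ ⁻¹' P) y : Set (Fin d → ℝ)) = ⊤ := by
  rw [eq_top_iff]
  intro z _
  set U := Submodule.span ℝ (dirCone (chart u φ ⁻¹' P) y : Set (Fin d → ℝ)) with hU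
  have hle : dirSpace P ≤ U.map ((dirSpace P).subtype.comp φ.symm.toLinearMap) := by
    refine (direction_affineSpan ℝ P).le.trans ?_
    rw [vectorSpan_eq_span_vsub_set_right ℝ hy, Submodule.span_le]
    rintro _ ⟨p, hp, rfl⟩
    obtain ⟨p, rfl⟩ := subset_range_chart (φ := φ) hu hp
    exact ⟨p - y, Submodule.subset_span (sub_mem_dirCone hp), (chart_sub p y).symm⟩
  obtain ⟨z', hz', hzz⟩ := hle (φ.symm z).2
  have : z' = z := φ.symm.injective (Subtype.ext hzz)
  exact this ▸ hz'

/-- The polytope `P`, written in lattice coordinates centred at one of its lattice points,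
is `c`. -/
def HasChart (P : Σ n : ℕ, Set (Fin n → ℝ)) (c : Σ d : ℕ, Set (Fin d → ℝ)) : Prop :=
  ∃ u ∈ P.2, u ∈ intLattice P.1 ∧ ∃ φ : dirSpace P.2 ≃ₗ[ℝ] (Fin c.1 → ℝ),
    (∀ x : dirSpace P.2, (x : Fin P.1 → ℝ) ∈ intLattice P.1 ↔ φ x ∈ intLattice c.1) ∧
    chart u φ ⁻¹' P.2 = c.2

lemma HasChart.integrallyEquivalent {P Q : Σ n : ℕ, Set (Fin n → ℝ)} {c : Σ d : ℕ, Set (Fin d → ℝ)}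
    (hP : HasChart P c) (hQ : HasChart Q c) : IntegrallyEquivalent P.2 Q.2 := by
  obtain ⟨d, C⟩ := c
  obtain ⟨u, huP, huL, φ, hφ, hPC⟩ := hP
  obtain ⟨w, hwQ, hwL, ψ, hψ, hQC⟩ := hQ
  dsimp only at φ ψ hφ hψ hPC hQC
  -- The change of charts lives on the parallel space only, while an affine map of the ambient space
  -- is required.
  obtain ⟨g, hg⟩ := LinearMap.exists_extend
    (((dirSpace Q.2).subtype.comp ψ.symm.toLinearMap).comp φ.toLinearMap)
  have hg' : ∀ x : dirSpace P.2, g x = (ψ.symm (φ x) : Fin Q.1 → ℝ) := fun x =>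
    LinearMap.congr_fun hg x
  let f : (Fin P.1 → ℝ) →ᵃ[ℝ] (Fin Q.1 → ℝ) :=
    AffineMap.const ℝ _ w + (g.toAffineMap - AffineMap.const ℝ _ (g u))
  have hf : ∀ y, f (chart u φ y) = chart w ψ y := by
    intro y
    change w + (g (chart u φ y) - g u) = _
    rw [chart_apply, chart_apply, map_add, add_sub_cancel_left, hg', φ.apply_symm_apply]
  have haff : ∀ {n : ℕ} {R : Set (Fin n → ℝ)} {r : Fin n → ℝ} (hr : r ∈ R)
      (χ : dirSpace R ≃ₗ[ℝ] (Fin d → ℝ)) (y : Fin d → ℝ), chart r χ y ∈ affineSpan ℝ R := by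
    intro n R r hr χ y
    rw [chart_apply, add_comm]
    exact AffineSubspace.vadd_mem_of_mem_direction (χ.symm y).2 (subset_affineSpan ℝ R hr)
  refine ⟨f, ⟨?_, ?_, ?_⟩, ?_⟩
  · rintro p ⟨hpL, hp⟩
    obtain ⟨x, -, rfl⟩ := exists_chart_eq (φ := φ) huP hp
    rw [hf]
    exact ⟨(chart_mem_intLattice hwL hψ).2 ((chart_mem_intLattice huL hφ).1 hpL), haff hwQ ψ _⟩
  · rintro p ⟨-, hp⟩ q ⟨-, hq⟩ hpq
    obtain ⟨x, -, rfl⟩ := exists_chart_eq (φ := φ) huP hp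
    obtain ⟨y, -, rfl⟩ := exists_chart_eq (φ := φ) huP hq
    rw [hf, hf] at hpq
    rw [chart_injective hpq]
  · rintro p ⟨hpL, hp⟩
    obtain ⟨x, -, rfl⟩ := exists_chart_eq (φ := ψ) hwQ hp
    exact ⟨chart u φ (ψ x), ⟨(chart_mem_intLattice huL hφ).2
      ((chart_mem_intLattice hwL hψ).1 hpL), haff huP φ _⟩, hf _⟩
  · rw [← image_chart_preimage (φ := φ) huP, hPC, Set.image_image]
    simp only [hf]
    rw [← hQC, image_chart_preimage hwQ]

end Chart

/-! ### From finitely many charts to the theorem -/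

lemma finitelyManyUpToEquivalence_of_code {κ : Type*} {C : Set (Σ n : ℕ, Set (Fin n → ℝ))}
    {K : Set κ} (hK : K.Finite) (R : (Σ n : ℕ, Set (Fin n → ℝ)) → κ → Prop)
    (hex : ∀ P ∈ C, ∃ c ∈ K, R P c)
    (hR : ∀ P Q c, R P c → R Q c → IntegrallyEquivalent P.2 Q.2) :
    FinitelyManyUpToEquivalence C := by
  classical
  have hfin : {c ∈ K | ∃ P ∈ C, R P c}.Finite := hK.subset fun c hc => hc.1
  -- One representative per code realized in `C`; the default value is never used on such codes.
  let g : κ → Σ n : ℕ, Set (Fin n → ℝ) := fun c =>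
    if h : ∃ P ∈ C, R P c then h.choose else ⟨0, ∅⟩
  have hg : ∀ c, (∃ P ∈ C, R P c) → g c ∈ C ∧ R (g c) c := fun c h => by
    simp only [g, dif_pos h]
    exact h.choose_spec
  refine ⟨g '' {c ∈ K | ∃ P ∈ C, R P c}, ?_, hfin.image g, fun P hP => ?_⟩
  · rintro _ ⟨c, hc, rfl⟩
    exact (hg c hc.2).1
  · obtain ⟨c, hc, hPc⟩ := hex P hP
    exact ⟨g c, ⟨c, ⟨hc, P, hP, hPc⟩, rfl⟩, hR P _ c hPc (hg c ⟨P, hP, hPc⟩).2⟩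

/-- Finitely many coordinate polytopes account for all lattice polytopes with `k` lattice points
and normal cones in `F`. -/
lemma exists_finite_charts (k : ℕ) {F : Set (Σ m : ℕ, PointedCone ℝ (Fin m → ℝ))} (hfin : F.Finite)
    (hrat : ∀ σ ∈ F, IsRationalCone σ.2) :
    ∃ K : Set (Σ d : ℕ, Set (Fin d → ℝ)), K.Finite ∧
      ∀ P ∈ polytopesWith (k + 1) F, ∃ c ∈ K, HasChart P c := by
  choose B hB using fun (σ : Σ m : ℕ, PointedCone ℝ (Fin m → ℝ)) (hσ : σ ∈ F) =>
    exists_lattice_basis _ (hrat σ hσ).span_le (rfl : _ = coneDim σ.2)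
  let T : (d : ℕ) → Set (PointedCone ℝ (Fin d → ℝ)) := fun d =>
    ⋃ σ ∈ F, {τ | ∃ (hσ : σ ∈ F) (h : coneDim σ.2 = d),
      τ = coordDual σ.2 ((B σ hσ).reindex (finCongr h))}
  -- Each `σ` contributes at most one cone, the remaining choices being proofs.
  have hT : ∀ d, (T d).Finite := fun d => hfin.biUnion fun σ _ => by
    refine Set.Subsingleton.finite ?_
    rintro _ ⟨_, _, rfl⟩ _ ⟨_, _, rfl⟩
    rfl
  refine ⟨⋃ d ∈ (fun σ : Σ m : ℕ, PointedCone ℝ (Fin m → ℝ) => coneDim σ.2) '' F,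
    Sigma.mk d '' {C | IsFramed (k + 1) (T d) C},
    (hfin.image _).biUnion fun d _ => (finite_isFramed (k + 1) (hT d)).image _, ?_⟩
  rintro ⟨n, P⟩ ⟨hP, hcard, hnormal⟩
  dsimp only at hP hcard hnormal
  obtain ⟨S, hS, hSL⟩ := hP.exists_vertexSet
  have hPL : P.extremePoints ℝ ⊆ intLattice n := fun x hx => hSL ((hS.mem_iff x).2 hx)
  obtain ⟨u, hu⟩ : (P.extremePoints ℝ).Nonempty := by
    have hne : (P ∩ intLattice n).Nonempty := by
      rw [← Set.encard_ne_zero, hcard]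
      exact_mod_cast Nat.succ_ne_zero k
    refine IsCompact.extremePoints_nonempty ?_ (hne.mono Set.inter_subset_left)
    rw [hS.eq_hull]
    exact S.finite_toSet.isCompact_convexHull ℝ
  -- The dimension of `P` is that of a cone of `F`, so only finitely many dimensions occur.
  have hdim : ∀ w ∈ P.extremePoints ℝ, ∀ σ : Σ m : ℕ, PointedCone ℝ (Fin m → ℝ),
      ConesEquivalent (dualLattice P) (normalCone P w) (intLattice σ.1) σ.2 →
        coneDim σ.2 = polytopeDim P := by
    rintro w hw σ ⟨f, -⟩
    rw [coneDim, ← f.finrank_eq, span_normalCone hS hw, finrank_top, Subspace.dual_finrank_eq]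
    rfl
  have hcoord : ∀ w ∈ P.extremePoints ℝ, ∃ φ : dirSpace P ≃ₗ[ℝ] (Fin (polytopeDim P) → ℝ),
      (∀ x : dirSpace P, (x : Fin n → ℝ) ∈ intLattice n ↔ φ x ∈ intLattice _) ∧
      ∃ τ ∈ T (polytopeDim P), ∀ x, x ∈ tangentCone P w ↔ φ x ∈ τ := by
    intro w hw
    obtain ⟨σ, hσ, h⟩ := hnormal w hw
    have hd := hdim w hw σ h
    obtain ⟨φ, hφ, hφC⟩ := exists_coordinates hP hw ((B σ hσ).reindex (finCongr hd)) (fun x => by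
      rw [hB σ hσ x, mem_intLattice, mem_intLattice, ← (finCongr hd).symm.forall_congr_right]
      simp [Module.Basis.equivFun_apply]) h
    exact ⟨φ, hφ, _, Set.mem_biUnion hσ ⟨hσ, hd, rfl⟩, hφC⟩
  obtain ⟨φ, hφ, τ, hτ, hφC⟩ := hcoord u hu
  obtain ⟨σ, hσ, hσe⟩ := hnormal u hu
  have huL := hPL hu
  have hconv := hS.convex
  have hext : ∀ y, y ∈ (chart u φ ⁻¹' P).extremePoints ℝ ↔ chart u φ y ∈ P.extremePoints ℝ :=
    fun y => mem_extremePoints_preimage chart_injective (subset_range_chart hu.1)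
  have hzero : chart u φ 0 = u := by simp [chart_apply]
  refine ⟨⟨polytopeDim P, chart u φ ⁻¹' P⟩, Set.mem_biUnion ⟨σ, hσ, hdim u hu σ hσe⟩ ⟨_, ?_, rfl⟩,
    u, hu.1, huL, φ, hφ, rfl⟩
  have hcone : ∀ y, chart u φ y ∈ P → ∀ x, x ∈ dirCone (chart u φ ⁻¹' P) y ↔
      φ.symm x ∈ tangentCone P (chart u φ y) := fun y hy x => by
    rw [mem_dirCone_chart hu.1 hconv hy, mem_tangentCone hconv hy]
  refine ⟨isLatticePolytope_chart hu.1 huL hφ hP, ?_, ?_, ?_, fun y hy => ?_, fun y hy => ?_⟩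
  · rw [encard_chart hu.1 huL hφ, hcard]
  · rw [hext, hzero]
    exact hu
  · have : dirCone (chart u φ ⁻¹' P) 0 = τ := by
      ext x
      rw [hcone 0 (by rw [hzero]; exact hu.1), hzero, hφC, φ.apply_symm_apply]
    rwa [this]
  · exact span_dirCone_chart hu.1 ((hext y).1 hy).1
  · obtain ⟨ψ, hψ, τ', hτ', hψC⟩ := hcoord _ ((hext y).1 hy)
    -- The change between the coordinates adapted to the base vertex and those adapted to the
    -- current one is unimodular.
    refine ⟨φ.symm.trans ψ, fun x => ?_, τ', hτ', fun x => ?_⟩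
    · rw [LinearEquiv.trans_apply, ← hψ, hφ, φ.apply_symm_apply]
    · rw [hcone y ((hext y).1 hy).1, hψC]
      rfl

end LatticePolytopes

/-- First part: lattice `d`-polytopes and a finite family of rational `d`-cones, for a fixed `d`.
Second part: the same without fixing the dimension of the polytopes and of the cones. -/
theorem mainTheorem2 (N : ℕ) (F : Set (Σ m : ℕ, PointedCone ℝ (Fin m → ℝ))) (hfin : F.Finite)
    (hrat : ∀ σ ∈ F, LatticePolytopes.IsRationalCone σ.2) :
    (∀ d : ℕ, (∀ σ ∈ F, LatticePolytopes.coneDim σ.2 = d) →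
      LatticePolytopes.FinitelyManyUpToEquivalence
        {P ∈ LatticePolytopes.polytopesWith (N + 1) F | LatticePolytopes.polytopeDim P.2 = d}) ∧
    LatticePolytopes.FinitelyManyUpToEquivalence (LatticePolytopes.polytopesWith (N + 1) F) := by
  obtain ⟨K, hK, hchart⟩ := LatticePolytopes.exists_finite_charts N hfin hrat
  have hequiv := fun P Q c => @LatticePolytopes.HasChart.integrallyEquivalent P Q c
  -- Representatives must belong to the class considered, so both parts are read off from the same
  -- finite set of charts separately.
  exact ⟨fun d _ => LatticePolytopes.finitelyManyUpToEquivalence_of_code hK _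
    (fun P hP => hchart P hP.1) hequiv,
    LatticePolytopes.finitelyManyUpToEquivalence_of_code hK _ hchart hequiv⟩
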